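/- All graphs are finite, simple and undirected. A vertex dominates itself and its neighbors, and an efficient dominating set (e.d.s.) of a graph $G=(V,E)$ is a set $D\subseteq V$ such that every vertex of $G$ is dominated by exactly one vertex of $D$. The Weighted Efficient Domination problem (WED) is: given $G=(V,E)$ and vertex weights $\omega:V\to\mathbb N\cup\{\infty\}$, find an e.d.s. of $G$ of minimum finite total weight, or determine that $G$ has no e.d.s. of finite total weight. A graph is chordal if it has no induced cycle with four or more vertices; the net is the graph on six vertices that consists of a triangle together with three further vertices of degree one, attached to the three different vertices of the triangle; and a graph is net-free if it has no induced subgraph isomorphic to the net. **Corollary.** WED is solvable in time $O(n^3)$ for net-free chordal graphs, where $n$ is the number of vertices. That is, there is a random access machine program which, for every net-free chordal graph $G$ with $n$ vertices (given by its adjacency matrix) and all vertex weights $\omega:V\to\mathbb N\cup\{\infty\}$, halts with a correct answer to the instance $(G,\omega)$ of WED after at most $T(n)$ steps, where $T(n)=O(n^3)$ does not depend on $G$ and $\omega$. Here each constant, memory access, addition, truncated subtraction, multiplication, comparison and test of a condition takes at most a constant number of steps, and memory words have $O(\log(n+W+2))$ bits, where $W$ is the largest finite vertex weight. -/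

import Mathlib

/-! ## Graph notions -/

/-- A graph is chordal if it has no induced cycle on four or more vertices. -/
def IsChordal {V : Type*} (G : SimpleGraph V) : Prop :=
  ∀ k : ℕ, 4 ≤ k → ¬ (SimpleGraph.cycleGraph k).IsIndContained G

/-- The net. The vertices `0, 1, 2, 3` induce the path `0 - 1 - 2 - 3`, vertex `4` is adjacent to
the two mid-points of this path (so far this is the bull), and vertex `5` is adjacent to exactly
the vertex `4`. -/
def net : SimpleGraph (Fin 6) :=
  SimpleGraph.fromEdgeSet {s(0, 1), s(1, 2), s(2, 3), s(4, 1), s(4, 2), s(4, 5)}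

/-- A graph is net-free if it has no induced subgraph isomorphic to the net. -/
def IsNetFree {V : Type*} (G : SimpleGraph V) : Prop :=
  ¬ net.IsIndContained G

/-- `D` is an efficient dominating set of `G`: every vertex is dominated by exactly one vertex of
`D`, where a vertex dominates itself and its neighbors. -/
def IsEfficientDominating {V : Type*} (G : SimpleGraph V) (D : Finset V) : Prop :=
  ∀ v : V, ∃! d : V, d ∈ D ∧ (d = v ∨ G.Adj d v)

/-- The total weight of a vertex set; it is `⊤` as soon as one vertex has weight `⊤`. -/
def totalWeight {V : Type*} (w : V → ℕ∞) (D : Finset V) : ℕ∞ :=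
  ∑ v ∈ D, w v

/-- The correct answers to the instance `(G, w)` of Weighted Efficient Domination: an efficient
dominating set of minimum finite total weight, or `none` if there is no efficient dominating set
of finite total weight. -/
def IsWEDAnswer {V : Type*} (G : SimpleGraph V) (w : V → ℕ∞) : Option (Finset V) → Prop
  | some D => IsEfficientDominating G D ∧ totalWeight w D ≠ ⊤ ∧
      ∀ D' : Finset V, IsEfficientDominating G D' → totalWeight w D ≤ totalWeight w D'
  | none => ∀ D : Finset V, IsEfficientDominating G D → totalWeight w D = ⊤

/-! ## Random access machines

A machine has registers and arrays, both named by natural numbers, whose cells hold natural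
numbers not larger than a bound `B` (the largest machine word). A program is a fixed finite text,
so it names only finitely many registers and arrays. Array indices are computed at run time
(indirect addressing). -/

namespace RAM

/-- The content of the memory. -/
structure State where
  /-- the registers -/
  reg : ℕ → ℕ
  /-- the arrays: `arr a i` is the cell with index `i` of the array with name `a` -/
  arr : ℕ → ℕ → ℕ

/-- The arithmetic and comparison instructions. -/
inductive Op where
  | add
  | sub
  | mul
  | lt
  | eq

/-- The value of an instruction. Subtraction is truncated at zero; a comparison yields `1` if it
holds and `0` otherwise. -/
def Op.eval : Op → ℕ → ℕ → ℕ
  | .add, a, b => a + b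
  | .sub, a, b => a - b
  | .mul, a, b => a * b
  | .lt, a, b => if a < b then 1 else 0
  | .eq, a, b => if a = b then 1 else 0

/-- Expressions: constants, the register `x`, the cell of the array `a` whose index is the value of
an expression, and the result of an instruction. -/
inductive Expr where
  | const (c : ℕ)
  | reg (x : ℕ)
  | read (a : ℕ) (index : Expr)
  | op (o : Op) (e₁ e₂ : Expr)

/-- The value of an expression. -/
def Expr.eval (s : State) : Expr → ℕ
  | .const c => c
  | .reg x => s.reg x
  | .read a e => s.arr a (e.eval s)
  | .op o e₁ e₂ => o.eval (e₁.eval s) (e₂.eval s)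

/-- The number of steps for evaluating an expression: one for each constant, register access,
array access and instruction in it. -/
def Expr.cost : Expr → ℕ
  | .const _ => 1
  | .reg _ => 1
  | .read _ e => e.cost + 1
  | .op _ e₁ e₂ => e₁.cost + e₂.cost + 1

/-- No word overflows in evaluating the expression: it and all its subexpressions have values
at most `B`. -/
def Expr.Fits (B : ℕ) (s : State) : Expr → Prop
  | .const c => c ≤ B
  | .reg x => s.reg x ≤ B
  | .read a e => e.Fits B s ∧ s.arr a (e.eval s) ≤ B
  | .op o e₁ e₂ => e₁.Fits B s ∧ e₂.Fits B s ∧ o.eval (e₁.eval s) (e₂.eval s) ≤ B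

/-- Programs. A condition is true if its value is not zero. -/
inductive Prog where
  | skip
  | assign (x : ℕ) (e : Expr)
  | store (a : ℕ) (index e : Expr)
  | seq (p q : Prog)
  | ite (cond : Expr) (p q : Prog)
  | while (cond : Expr) (p : Prog)

/-- Write `v` into the register `x`. -/
def State.setReg (s : State) (x v : ℕ) : State :=
  { s with reg := Function.update s.reg x v }

/-- Write `v` into the cell with index `i` of the array `a`. -/
def State.setArr (s : State) (a i v : ℕ) : State :=
  { s with arr := Function.update s.arr a (Function.update (s.arr a) i v) }

/-- `Run B p s t s'`: started in the state `s` on a machine with words up to `B`, the program `p`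
halts after `t` steps in the state `s'`. An overflow makes the program stuck: it then has no
run. -/
inductive Run (B : ℕ) : Prog → State → ℕ → State → Prop
  | skip (s : State) : Run B .skip s 1 s
  | assign (x : ℕ) (e : Expr) (s : State) (h : e.Fits B s) :
      Run B (.assign x e) s (e.cost + 1) (s.setReg x (e.eval s))
  | store (a : ℕ) (i e : Expr) (s : State) (hi : i.Fits B s) (h : e.Fits B s) :
      Run B (.store a i e) s (i.cost + e.cost + 1) (s.setArr a (i.eval s) (e.eval s))
  | seq {p q : Prog} {s s' s'' : State} {t t' : ℕ} (hp : Run B p s t s') (hq : Run B q s' t' s'') :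
      Run B (.seq p q) s (t + t') s''
  | ite_true {c : Expr} {p q : Prog} {s s' : State} {t : ℕ} (hc : c.Fits B s)
      (h : c.eval s ≠ 0) (hp : Run B p s t s') :
      Run B (.ite c p q) s (c.cost + 1 + t) s'
  | ite_false {c : Expr} {p q : Prog} {s s' : State} {t : ℕ} (hc : c.Fits B s)
      (h : c.eval s = 0) (hq : Run B q s t s') :
      Run B (.ite c p q) s (c.cost + 1 + t) s'
  | while_true {c : Expr} {p : Prog} {s s' s'' : State} {t t' : ℕ} (hc : c.Fits B s)
      (h : c.eval s ≠ 0) (hp : Run B p s t s') (hw : Run B (.while c p) s' t' s'') :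
      Run B (.while c p) s (c.cost + 1 + t + t') s''
  | while_false {c : Expr} {p : Prog} {s : State} (hc : c.Fits B s) (h : c.eval s = 0) :
      Run B (.while c p) s (c.cost + 1) s

end RAM

/-! ## Solving Weighted Efficient Domination on a machine -/

namespace WED

/-- The code of a weight in a memory cell: `0` for `∞`, and `m + 1` for the natural number `m`. -/
def weightCode : ℕ∞ → ℕ
  | none => 0
  | some m => m + 1

open Classical in
/-- The initial state for the instance `(G, w)`: register `0` holds the number `n` of vertices,
array `0` the adjacency matrix of `G` (row by row), array `1` the vertex weights, and all other
cells are zero. -/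
noncomputable def input {n : ℕ} (G : SimpleGraph (Fin n)) (w : Fin n → ℕ∞) : RAM.State where
  reg x := if x = 0 then n else 0
  arr a k :=
    if a = 0 then (if ∃ i j : Fin n, k = i.val * n + j.val ∧ G.Adj i j then 1 else 0)
    else if a = 1 then (if h : k < n then weightCode (w ⟨k, h⟩) else 0)
    else 0

/-- The answer in a final state: `none` if register `0` is zero, and otherwise the set of the
vertices `i` such that cell `i` of array `0` is not zero. -/
def output (n : ℕ) (s : RAM.State) : Option (Finset (Fin n)) :=
  if s.reg 0 = 0 then none else some (Finset.univ.filter fun i : Fin n => s.arr 0 i.val ≠ 0)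

/-- The largest finite weight of a vertex (`0` if there is none). -/
def maxFiniteWeight {n : ℕ} (w : Fin n → ℕ∞) : ℕ :=
  Finset.univ.sup fun i => (w i).toNat

/-- WED is solvable in time `T` on the graph class `C`: there are a program and a constant `k` such
that on all instances `(G, w)` with `G` in `C` on `n` vertices, and with words of
`k * log₂ (n + W + 2)` bits, where `W` is the largest finite weight, the program halts within
`T n` steps with a correct answer. -/
def SolvableInTime (C : ∀ n : ℕ, SimpleGraph (Fin n) → Prop) (T : ℕ → ℕ) : Prop :=
  ∃ (p : RAM.Prog) (k : ℕ), ∀ (n : ℕ) (G : SimpleGraph (Fin n)) (w : Fin n → ℕ∞), C n G →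
    ∃ (t : ℕ) (s : RAM.State),
      RAM.Run ((n + maxFiniteWeight w + 2) ^ k) p (input G w) t s ∧
      t ≤ T n ∧ IsWEDAnswer G w (output n s)

end WED

/-! Two vertices conflict if their distance is at most two (a vertex conflicts with itself), so an
efficient dominating set (e.d.s.) is a set that is independent in the square of `G` and whose closed
neighborhoods have total size `n`. Choose `B` larger than the sum of all finite weights and give a
vertex `v` of finite weight the value `|N[v]| * B - w v`. A maximum value independent set of the
square first maximizes the number of dominated vertices and then minimizes the weight, so it answers
WED (`isWEDAnswer_of_optimal`).

The graph theory is `exists_simplicial_conflict`: if a net-free chordal graph has an e.d.s. `D`,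
every induced subgraph of its square has a simplicial vertex. For a vertex set `S` inside one
component of `G`, take `d ∈ D` dominating a vertex of `S` and a component `R` of `G - N[d]` with `|S
∩ R|` maximal; then `S ⊆ N[d] ∪ R`. Chordality makes the vertices of `N(d)` with neighbors in `R` a
clique. A net would appear if two vertices of `R` on the boundary with `N(d)` had different
dominators in `D`; hence the boundary has a single dominator and is a clique as well. A vertex of `S
∩ N[d]` whose reach into `R` is minimal is then simplicial.

Eliminating simplicial vertices one by one, an optimal independent set is found by the local ratio
method (`sum_le_sum_select`): the eliminated vertex passes its current value on as a reduction of
its neighbors' values, and vertices are selected greedily in the reverse order.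

If there is no e.d.s., the elimination may go wrong, but the selected set is still independent. It
then dominates fewer than `n` vertices, and the answer `none` is correct. So no recognition of the
bad case is needed.

For cubic time the program keeps a matrix of defects, counting for `(i, j)` the alive vertices in
conflict with `j` but not with `i`. A vertex is simplicial when it has zero defect towards all its
alive neighbors. Computing the matrix takes cubic time once; each of the `n` rounds searches and
updates it in quadratic time. Running time and absence of overflow are read off from the program
text by a small program logic (`WP`). -/

namespace SimpleGraph

/-! ### Walks in chordal graphs, and nets -/

variable {V : Type*} {G : SimpleGraph V}

/-- The vertices `u` and `w` are joined by a walk inside `K`. -/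
def Linked (G : SimpleGraph V) (K : Set V) (u w : V) : Prop :=
  ∃ p : G.Walk u w, ∀ z ∈ p.support, z ∈ K

theorem Linked.refl {K : Set V} {u : V} (hu : u ∈ K) : G.Linked K u u :=
  ⟨Walk.nil, by simpa using hu⟩

theorem Linked.symm {K : Set V} {u w : V} (h : G.Linked K u w) : G.Linked K w u := by
  obtain ⟨p, hp⟩ := h
  exact ⟨p.reverse, by simpa using hp⟩

theorem Linked.trans {K : Set V} {u v w : V} (h : G.Linked K u v) (h' : G.Linked K v w) :
    G.Linked K u w := by
  obtain ⟨p, hp⟩ := h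
  obtain ⟨q, hq⟩ := h'
  refine ⟨p.append q, fun z hz => ?_⟩
  rcases Walk.mem_support_append_iff p q |>.1 hz with hz | hz
  exacts [hp z hz, hq z hz]

theorem Linked.mono {K L : Set V} (hKL : K ⊆ L) {u w : V} (h : G.Linked K u w) :
    G.Linked L u w := by
  obtain ⟨p, hp⟩ := h
  exact ⟨p, fun z hz => hKL (hp z hz)⟩

theorem Linked.left_mem {K : Set V} {u w : V} (h : G.Linked K u w) : u ∈ K := by
  obtain ⟨p, hp⟩ := h
  exact hp _ p.start_mem_support

theorem Linked.right_mem {K : Set V} {u w : V} (h : G.Linked K u w) : w ∈ K := h.symm.left_mem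

theorem Adj.linked {K : Set V} {u w : V} (h : G.Adj u w) (hu : u ∈ K) (hw : w ∈ K) :
    G.Linked K u w :=
  ⟨Walk.cons h Walk.nil, by simp [hu, hw]⟩

theorem Linked.exists_crossing {K : Set V} {u w : V} (h : G.Linked K u w) (P : V → Prop)
    (hu : P u) (hw : ¬ P w) : ∃ y z, y ∈ K ∧ z ∈ K ∧ G.Adj y z ∧ P y ∧ ¬ P z := by
  obtain ⟨p, hp⟩ := h
  induction p with
  | nil => exact absurd hu hw
  | @cons a b c hab q ih =>
    have ha : a ∈ K := hp a (by simp)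
    have hb : b ∈ K := hp b (by simp)
    by_cases hPb : P b
    · exact ih hPb hw fun z hz => hp z (by simp [hz])
    · exact ⟨a, b, ha, hb, hab, hu, hPb⟩

/-- In a chordal graph, two neighbors of `c` that are joined by a walk avoiding the rest of the
closed neighborhood of `c` are equal or adjacent. -/
theorem _root_.IsChordal.eq_or_adj (hG : IsChordal G) {K : Set V} {c x y : V} (hx : G.Adj c x)
    (hy : G.Adj c y) (h : G.Linked K x y)
    (hK : ∀ z ∈ K, z = x ∨ z = y ∨ (z ≠ c ∧ ¬ G.Adj c z)) : x = y ∨ G.Adj x y := by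
  classical
  by_contra hcon
  push Not at hcon
  obtain ⟨hxy, hnadj⟩ := hcon
  -- A shortest walk inside `K` has no repetitions and no chords. Together with `c`, which sees only
  -- its ends, it is an induced cycle on `m + 2 ≥ 4` vertices.
  have hex : ∃ m, ∃ p : G.Walk x y, (∀ z ∈ p.support, z ∈ K) ∧ p.length = m := by
    obtain ⟨p, hp⟩ := h
    exact ⟨_, p, hp, rfl⟩
  obtain ⟨p, hp, hlen⟩ := Nat.find_spec hex
  set m := Nat.find hex with hm
  have hmin : ∀ q : G.Walk x y, (∀ z ∈ q.support, z ∈ K) → m ≤ q.length :=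
    fun q hq => Nat.find_min' hex ⟨q, hq, rfl⟩
  have hmemt : ∀ i, ∀ z ∈ (p.take i).support, z ∈ K := fun i z hz =>
    hp z ((p.isSubwalk_take i).support_subset hz)
  have hmemd : ∀ i, ∀ z ∈ (p.drop i).support, z ∈ K := fun i z hz =>
    hp z ((p.isSubwalk_drop i).support_subset hz)
  have hvK : ∀ i, p.getVert i ∈ K := fun i => hp _ (p.getVert_mem_support i)
  have hinj : ∀ i j, i < j → j ≤ m → p.getVert i ≠ p.getVert j := by
    intro i j hij hj he
    have := hmin ((p.take i).append ((p.drop j).copy he.symm rfl)) (by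
      intro z hz
      rcases (Walk.mem_support_append_iff _ _).1 hz with hz | hz
      · exact hmemt i z hz
      · exact hmemd j z (by simpa using hz))
    simp [hlen] at this
    omega
  have hchord : ∀ i j, i + 1 < j → j ≤ m → ¬ G.Adj (p.getVert i) (p.getVert j) := by
    intro i j hij hj he
    have := hmin ((p.take i).append (Walk.cons he (p.drop j))) (by
      intro z hz
      rcases (Walk.mem_support_append_iff _ _).1 hz with hz | hz
      · exact hmemt i z hz
      · rw [Walk.support_cons, List.mem_cons] at hz
        rcases hz with rfl | hz
        · exact hvK i
        · exact hmemd j z hz)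
    simp [hlen] at this
    omega
  have hstep : ∀ i, i < m → G.Adj (p.getVert i) (p.getVert (i + 1)) := fun i hi =>
    p.adj_getVert_succ (by omega)
  have h0 : p.getVert 0 = x := p.getVert_zero
  have hmv : p.getVert m = y := by rw [← hlen]; exact p.getVert_length
  have hm2 : 2 ≤ m := by
    by_contra hlt
    have : m = 0 ∨ m = 1 := by omega
    rcases this with h | h
    · rw [h, h0] at hmv; exact hxy hmv
    · have := hstep 0 (by omega)
      rw [h0, zero_add, ← h, hmv] at this
      exact hnadj this
  have hc : ∀ i ≤ m, p.getVert i ≠ c ∧ (G.Adj c (p.getVert i) ↔ i = 0 ∨ i = m) := by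
    intro i hi
    rcases hK _ (hvK i) with h | h | h
    · have : i = 0 := by
        by_contra hne
        exact hinj 0 i (by omega) hi (h0.trans h.symm)
      rw [h]; simp [this, hx, hx.ne']
    · have : i = m := by
        by_contra hne
        exact hinj i m (by omega) le_rfl (h.trans hmv.symm)
      rw [h]; simp [this, hy, hy.ne']
    · refine ⟨h.1, iff_of_false h.2 ?_⟩
      rintro (rfl | rfl)
      · exact h.2 (by rw [h0]; exact hx)
      · exact h.2 (by rw [hmv]; exact hy)
  let f : Fin (m + 2) → V := fun i => if i.val ≤ m then p.getVert i.val else c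
  have hadj : ∀ i j, i < j → j ≤ m → (G.Adj (p.getVert i) (p.getVert j) ↔ j = i + 1) := by
    intro i j hij hj
    constructor
    · intro h
      by_contra hne
      exact hchord i j (by omega) hj h
    · rintro rfl
      exact hstep i (by omega)
  have hcyc : ∀ i j : Fin (m + 2), i < j →
      ((cycleGraph (m + 2)).Adj i j ↔ (j.val = i.val + 1 ∨ (i.val = 0 ∧ j.val = m + 1))) := by
    intro i j hij
    rw [cycleGraph_adj', Fin.sub_val_of_le hij.le]
    have : ((i - j : Fin (m + 2))).val = m + 2 + i.val - j.val := by
      rw [Fin.val_sub]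
      have := i.2; have := j.2
      rw [Nat.mod_eq_of_lt] <;> omega
    rw [this]
    have := i.2; have := j.2
    have : i.val < j.val := hij
    omega
  have key : ∀ i j : Fin (m + 2), i < j →
      f i ≠ f j ∧ (G.Adj (f i) (f j) ↔ (cycleGraph (m + 2)).Adj i j) := by
    intro i j hij
    have hi := i.2
    have hj := j.2
    have hij' : i.val < j.val := hij
    rw [hcyc i j hij]
    simp only [f]
    rw [if_pos (show i.val ≤ m by omega)]
    by_cases hjm : j.val ≤ m
    · rw [if_pos hjm]
      refine ⟨hinj _ _ hij' hjm, ?_⟩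
      rw [hadj _ _ hij' hjm]
      omega
    · rw [if_neg hjm, G.adj_comm]
      refine ⟨(hc i (by omega)).1, ?_⟩
      rw [(hc i (by omega)).2]
      omega
  refine hG (m + 2) (by omega) ⟨⟨⟨f, ?_⟩, ?_⟩⟩
  · intro i j he
    rcases lt_trichotomy i j with h | h | h
    · exact absurd he (key i j h).1
    · exact h
    · exact absurd he.symm (key j i h).1
  · intro i j
    rcases lt_trichotomy i j with h | h | h
    · exact (key i j h).2
    · simp [h]
    · exact (G.adj_comm _ _).trans ((key j i h).2.trans ((cycleGraph _).adj_comm _ _))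

theorem _root_.IsChordal.adj_of_square (hG : IsChordal G) {a b c d : V} (hab : G.Adj a b)
    (hbc : G.Adj b c) (hcd : G.Adj c d) (hda : G.Adj d a) (hac : a ≠ c) (hbd : b ≠ d) :
    G.Adj a c ∨ G.Adj b d := by
  by_contra hcon
  push Not at hcon
  rcases hG.eq_or_adj (K := {a, d, c}) hab.symm hbc
    ((hda.symm.linked (by simp) (by simp)).trans (hcd.symm.linked (by simp) (by simp)))
    (by
      rintro z (rfl | rfl | rfl)
      · simp
      · exact Or.inr (Or.inr ⟨hbd.symm, hcon.2⟩)
      · simp) with h | h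
  · exact hac h
  · exact hcon.1 h

/-- In a chordal graph, two neighbors of `a` that are joined inside `K` are joined by neighbors
of `a` inside `K`. -/
theorem _root_.IsChordal.linked_neighbors (hG : IsChordal G) {K : Set V} {a b w : V} (haK : a ∉ K)
    (hb : G.Adj a b) (hw : G.Adj a w) (h : G.Linked K b w) :
    G.Linked {z | z ∈ K ∧ G.Adj a z} b w := by
  have hbK : b ∈ K := h.left_mem
  obtain ⟨p, hp⟩ := h
  -- Induction along the walk: `b` is the last neighbor of `a` that was met, and `u` the current
  -- position, reached from `b` through non-neighbors of `a`. Whenever `u` is again a neighbor of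
  -- `a`, `IsChordal.eq_or_adj` replaces the detour by an edge.
  suffices H : ∀ (u w : V) (p : G.Walk u w), (∀ z ∈ p.support, z ∈ K) → G.Adj a w → ∀ b, b ∈ K →
      G.Adj a b → G.Linked {z | z = b ∨ z = u ∨ (z ∈ K ∧ ¬ G.Adj a z)} b u →
      G.Linked {z | z ∈ K ∧ G.Adj a z} b w from
    H b w p hp hw b hbK hb (Linked.refl (by simp))
  clear! b w
  intro u w p
  have hswitch : ∀ b u, b ∈ K → G.Adj a b → u ∈ K → G.Adj a u →
      G.Linked {z | z = b ∨ z = u ∨ (z ∈ K ∧ ¬ G.Adj a z)} b u →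
      G.Linked {z | z ∈ K ∧ G.Adj a z} b u := by
    intro b u hb hab hu hau hl
    rcases hG.eq_or_adj hab hau hl (by
      rintro z (h | h | h)
      · exact Or.inl h
      · exact Or.inr (Or.inl h)
      · exact Or.inr (Or.inr ⟨fun e => haK (e ▸ h.1), h.2⟩)) with h | h
    · subst h
      exact Linked.refl ⟨hb, hab⟩
    · exact h.linked ⟨hb, hab⟩ ⟨hu, hau⟩
  induction p with
  | @nil u =>
    intro hp hw b hb hab hl
    exact hswitch b u hb hab (hp u (by simp)) hw hl
  | @cons u v w huv q ih =>
    intro hp hw b hb hab hl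
    have hu : u ∈ K := hp u (by simp)
    have hq : ∀ z ∈ q.support, z ∈ K := fun z hz => hp z (by simp [hz])
    by_cases hau : G.Adj a u
    · exact (hswitch b u hb hab hu hau hl).trans
        (ih hq hw u hu hau (huv.linked (by simp) (by simp)))
    · refine ih hq hw b hb hab ((hl.mono ?_).trans (huv.linked ?_ ?_))
      · rintro z (h | h | h)
        · exact Or.inl h
        · exact Or.inr (Or.inr ⟨h ▸ hu, h ▸ hau⟩)
        · exact Or.inr (Or.inr h)
      · exact Or.inr (Or.inr ⟨hu, hau⟩)
      · exact Or.inr (Or.inl rfl)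

/-- A triangle whose vertices have private neighbors, pairwise non-adjacent, is a net. -/
theorem _root_.IsNetFree.not_net (hG : IsNetFree G) {a b c a' b' c' : V} (hab : G.Adj a b)
    (hbc : G.Adj b c) (hac : G.Adj a c) (ha : G.Adj a a') (hb : G.Adj b b') (hc : G.Adj c c')
    (hab' : ¬ G.Adj a b') (hac' : ¬ G.Adj a c') (hba' : ¬ G.Adj b a') (hbc' : ¬ G.Adj b c')
    (hca' : ¬ G.Adj c a') (hcb' : ¬ G.Adj c b') (h1 : ¬ G.Adj a' b') (h2 : ¬ G.Adj a' c')
    (h3 : ¬ G.Adj b' c') : False := by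
  let f : Fin 6 → V := ![a', a, b, b', c, c']
  have hf : ∀ i j, G.Adj (f i) (f j) ↔ net.Adj i j := by
    intro i j
    fin_cases i <;> fin_cases j <;>
      simp [f, net, hab, hbc, hac, ha, hb, hc, hab.symm, hbc.symm, hac.symm, ha.symm, hb.symm,
        hc.symm, hab', hac', hba', hbc', hca', hcb', h1, h2, h3, G.adj_comm a' b, G.adj_comm a' c,
        G.adj_comm b' a, G.adj_comm b' c, G.adj_comm c' a, G.adj_comm c' b, G.adj_comm b' a',
        G.adj_comm c' a', G.adj_comm c' b']
  -- Distinctness of the six vertices is not assumed: it follows because no two vertices of the net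
  -- have the same neighborhood.
  have htwin : ∀ i j : Fin 6, (∀ k, net.Adj i k ↔ net.Adj j k) → i = j := by
    unfold net
    simp only [fromEdgeSet_adj, Set.mem_insert_iff, Set.mem_singleton_iff]
    decide
  exact hG ⟨⟨⟨f, fun i j he => htwin i j fun k => by rw [← hf, ← hf, he]⟩, hf _ _⟩⟩

end SimpleGraph

/-! ### Simplicial vertices in the square -/

namespace SimpleGraph

variable {V : Type*} {G : SimpleGraph V}

/-- `x` dominates `y`: they are equal or adjacent. -/
def Dom (G : SimpleGraph V) (x y : V) : Prop := x = y ∨ G.Adj x y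

/-- `u` and `w` have a common dominator, that is, their distance is at most two. -/
def Conflict (G : SimpleGraph V) (u w : V) : Prop := ∃ x, G.Dom x u ∧ G.Dom x w

theorem Dom.symm {x y : V} (h : G.Dom x y) : G.Dom y x :=
  h.imp Eq.symm Adj.symm

theorem Dom.refl (x : V) : G.Dom x x := Or.inl rfl

theorem Conflict.symm {u w : V} (h : G.Conflict u w) : G.Conflict w u :=
  h.imp fun _ hx => hx.symm

theorem Linked.linked_component {K : Set V} {r z : V} (h : G.Linked K r z) :
    G.Linked {y | G.Linked K r y} r z := by
  obtain ⟨p, hp⟩ := h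
  suffices H : ∀ (x z : V) (p : G.Walk x z), (∀ y ∈ p.support, y ∈ K) → G.Linked K r x →
      G.Linked {y | G.Linked K r y} x z from H r z p hp (Linked.refl (hp r (by simp)))
  intro x z p
  induction p with
  | nil => exact fun _ hx => Linked.refl hx
  | @cons a b c hab q ih =>
    intro hp hx
    have hb : G.Linked K r b := hx.trans (hab.linked (hp a (by simp)) (hp b (by simp)))
    exact (hab.linked (K := {y | G.Linked K r y}) hx hb).trans
      (ih (fun y hy => hp y (by simp [hy])) hb)

theorem _root_.IsEfficientDominating.eq_of_dom {D : Finset V} (hD : IsEfficientDominating G D)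
    {d e v : V} (hd : d ∈ D) (he : e ∈ D) (hdv : G.Dom d v) (hev : G.Dom e v) : d = e :=
  (hD v).unique ⟨hd, hdv⟩ ⟨he, hev⟩

/-- The neighborhood `N[d]` of a vertex `d` of an efficient dominating set, together with a
component `R` of the rest of the graph. -/
structure StarSide (G : SimpleGraph V) (D : Finset V) (d : V) (R : Set V) : Prop where
  chordal : IsChordal G
  netFree : IsNetFree G
  eds : IsEfficientDominating G D
  mem : d ∈ D
  not_dom : ∀ z ∈ R, ¬ G.Dom d z
  closed : ∀ z ∈ R, ∀ y, G.Adj z y → ¬ G.Dom d y → y ∈ R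
  linked : ∀ z ∈ R, ∀ y ∈ R, G.Linked R z y

namespace StarSide

variable {D : Finset V} {d : V} {R : Set V}

/-- Both are neighbors of `d` joined through `R`, which lies outside `N[d]`, so chordality applies
with center `d`. -/
theorem attach_clique (h : G.StarSide D d R) {a a' b b' : V} (ha : G.Adj d a) (ha' : G.Adj d a')
    (hb : b ∈ R) (hb' : b' ∈ R) (hab : G.Adj a b) (hab' : G.Adj a' b') : a = a' ∨ G.Adj a a' := by
  refine h.chordal.eq_or_adj (K := R ∪ {a, a'}) ha ha' ?_ ?_
  · exact ((hab.linked (by simp) (by simp [hb])).trans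
      ((h.linked b hb b' hb').mono Set.subset_union_left)).trans
      (hab'.symm.linked (by simp [hb']) (by simp))
  · rintro z (hz | rfl | rfl)
    · have := h.not_dom z hz
      exact Or.inr (Or.inr ⟨fun e => this (Or.inl e.symm), fun e => this (Or.inr e)⟩)
    · simp
    · simp

/-- The vertex `a` is already dominated by `d`, hence by no other vertex of `D`; and `p ≠ d` since
`d` dominates nothing in `R`. -/
theorem not_adj_of_adj (h : G.StarSide D d R) {a p b : V} (ha : G.Adj d a) (hp : p ∈ D)
    (hpb : G.Dom p b) (hb : b ∈ R) : ¬ G.Adj a p ∧ p ≠ a ∧ p ≠ d := by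
  have hpd : p ≠ d := by
    rintro rfl
    exact h.not_dom b hb hpb
  refine ⟨fun e => hpd (h.eds.eq_of_dom hp h.mem (Or.inr e.symm) (Or.inr ha)), ?_, hpd⟩
  rintro rfl
  exact hpd (h.eds.eq_of_dom hp h.mem (Dom.refl p) (Or.inr ha))

/-- Inside `N(a) ∩ R` there is a walk from `b` to `z`. If the dominators differ, it has an edge `y
y'` that leaves the range of `p`, and the triangle `a y y'` with the pendant vertices `d`, `p` and
the dominator of `y'` is a net. -/
theorem dominator_eq_of_common (h : G.StarSide D d R) {a b z p q : V} (ha : G.Adj d a) (hb : b ∈ R)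
    (hz : z ∈ R) (hab : G.Adj a b) (haz : G.Adj a z) (hp : p ∈ D) (hq : q ∈ D) (hpb : G.Dom p b)
    (hqz : G.Dom q z) : p = q := by
  by_contra hpq
  have haR : a ∉ R := fun e => h.not_dom a e (Or.inr ha)
  obtain ⟨y, y', ⟨hy, hay⟩, ⟨hy', hay'⟩, hyy, hpy, hpy'⟩ :=
    (h.chordal.linked_neighbors haR hab haz (h.linked b hb z hz)).exists_crossing (G.Dom p) hpb
      (fun e => hpq (h.eds.eq_of_dom hp hq e hqz))
  obtain ⟨q', ⟨hq', hqy' : G.Dom q' y'⟩, -⟩ := h.eds y'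
  obtain ⟨h1, h2, h3⟩ := h.not_adj_of_adj ha hp hpy hy
  obtain ⟨h4, h5, h6⟩ := h.not_adj_of_adj ha hq' hqy' hy'
  have hpq' : p ≠ q' := by
    rintro rfl
    exact hpy' hqy'
  have hind : ∀ e ∈ D, ∀ f ∈ D, e ≠ f → ¬ G.Adj e f := fun e he f hf hne hadj =>
    hne (h.eds.eq_of_dom he hf (Or.inr hadj) (Dom.refl f))
  have hpy1 : G.Adj y p := by
    rcases hpy with rfl | e
    · exact absurd hay h1
    · exact e.symm
  have hqy1 : G.Adj y' q' := by
    rcases hqy' with rfl | e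
    · exact absurd hay' h4
    · exact e.symm
  exact h.netFree.not_net hay hyy hay' ha.symm hpy1 hqy1 h1 h4
    (fun e => h.not_dom y hy (Or.inr e.symm))
    (fun e => hpq' (h.eds.eq_of_dom hp hq' hpy (Or.inr e.symm)))
    (fun e => h.not_dom y' hy' (Or.inr e.symm))
    (fun e => hpy' (Or.inr e.symm)) (hind _ h.mem _ hp h3.symm) (hind _ h.mem _ hq' h6.symm)
    (hind _ hp _ hq' hpq')

/-- All boundary vertices of `R` have one dominator. If `a ≠ a'`, these are adjacent, and by
chordality they have a common neighbor `z` in `R`, which links the dominators of `b` and `b'`. -/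
theorem dominator_eq (h : G.StarSide D d R) {a a' b b' p p' : V} (ha : G.Adj d a)
    (ha' : G.Adj d a') (hb : b ∈ R) (hb' : b' ∈ R) (hab : G.Adj a b) (hab' : G.Adj a' b')
    (hp : p ∈ D) (hp' : p' ∈ D) (hpb : G.Dom p b) (hpb' : G.Dom p' b') : p = p' := by
  have haR : ∀ a, G.Adj d a → a ∉ R := fun a ha e => h.not_dom a e (Or.inr ha)
  rcases h.attach_clique ha ha' hb hb' hab hab' with rfl | haa
  · exact h.dominator_eq_of_common ha hb hb' hab hab' hp hp' hpb hpb'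
  · have hl : G.Linked (R ∪ {a'}) a' b :=
      -- The walk starts at `a'` and continues in `R`; once it is rerouted through neighbors of `a`,
      -- the edge on which it leaves `a'` ends in the common neighbor `z`.
      (hab'.linked (by simp) (by simp [hb'])).trans ((h.linked b' hb' b hb).mono (by simp))
    obtain ⟨y, z, -, ⟨hz, haz⟩, hyz, hy, hza⟩ :=
      (h.chordal.linked_neighbors (by simp [haR a ha, haa.ne]) haa hab hl).exists_crossing
        (· = a') rfl (by rintro rfl; exact haR _ ha' hb)
    subst hy
    have hzR : z ∈ R := hz.resolve_right hza
    obtain ⟨q, ⟨hq, hqz : G.Dom q z⟩, -⟩ := h.eds z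
    rw [h.dominator_eq_of_common ha hb hzR hab haz hp hq hpb hqz,
      h.dominator_eq_of_common ha' hb' hzR hab' hyz hp' hq hpb' hqz]

/-- The boundary of `R` is a clique: both vertices are neighbors of their common dominator `p`, and
the walk `b, a, a', b'` avoids the rest of `N[p]`. -/
theorem boundary_dom (h : G.StarSide D d R) {a a' b b' : V} (ha : G.Adj d a)
    (ha' : G.Adj d a') (hb : b ∈ R) (hb' : b' ∈ R) (hab : G.Adj a b) (hab' : G.Adj a' b') :
    G.Conflict b b' ∧ G.Dom b b' := by
  obtain ⟨p, ⟨hp, hpb : G.Dom p b⟩, -⟩ := h.eds b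
  obtain ⟨p', ⟨hp', hpb' : G.Dom p' b'⟩, -⟩ := h.eds b'
  obtain rfl := h.dominator_eq ha ha' hb hb' hab hab' hp hp' hpb hpb'
  refine ⟨⟨p, hpb, hpb'⟩, ?_⟩
  obtain ⟨h1, h2, -⟩ := h.not_adj_of_adj ha hp hpb hb
  obtain ⟨h3, h4, -⟩ := h.not_adj_of_adj ha' hp hpb hb
  have e1 : G.Adj p b := by
    rcases hpb with rfl | e
    · exact absurd hab h1
    · exact e
  have e2 : G.Adj p b' := by
    rcases hpb' with rfl | e
    · exact absurd hab' h3
    · exact e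
  refine h.chordal.eq_or_adj (K := {b, a, a', b'}) e1 e2 ?_ ?_
  · refine ((hab.symm.linked (by simp) (by simp)).trans (v := a) ?_).trans
      (hab'.linked (by simp) (by simp))
    rcases h.attach_clique ha ha' hb hb' hab hab' with rfl | e
    · exact Linked.refl (by simp)
    · exact e.linked (by simp) (by simp)
  · rintro z (rfl | rfl | rfl | rfl)
    · simp
    · exact Or.inr (Or.inr ⟨h2.symm, fun e => h1 e.symm⟩)
    · exact Or.inr (Or.inr ⟨h4.symm, fun e => h3 e.symm⟩)
    · simp

/-- How a vertex of `R` is at distance at most two from a vertex of `N[d]`. -/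
theorem conflict_cases (h : G.StarSide D d R) {v u : V} (hv : G.Dom d v) (hu : u ∈ R)
    (hvu : G.Conflict v u) :
    (∃ x, G.Adj d x ∧ G.Dom x v ∧ G.Adj x u) ∨ (∃ x ∈ R, G.Adj v x ∧ G.Dom x u) := by
  obtain ⟨x, hxv, hxu⟩ := hvu
  by_cases hdx : G.Dom d x
  · left
    rcases hxu with rfl | hxu
    · exact absurd hdx (h.not_dom x hu)
    · rcases hdx with rfl | hdx
      · exact absurd (Or.inr hxu) (h.not_dom u hu)
      · exact ⟨x, hdx, hxv, hxu⟩
  · right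
    have hxR : x ∈ R := by
      rcases hxu with rfl | hxu
      · exact hu
      · exact h.closed u hu x hxu.symm hdx
    refine ⟨x, hxR, ?_, hxu⟩
    rcases hxv with rfl | hxv
    · exact absurd hv hdx
    · exact hxv.symm

theorem adj_of_adj (h : G.StarSide D d R) {v x : V} (hv : G.Dom d v) (hx : x ∈ R)
    (hvx : G.Adj v x) : G.Adj d v := by
  rcases hv with rfl | hv
  · exact absurd (Or.inr hvx) (h.not_dom x hx)
  · exact hv

/-- If some vertex of `S ∩ N[d]` has no neighbor in `R`, then one of these is simplicial. -/
theorem exists_simplicial_of_interior [Finite V] (h : G.StarSide D d R) {S : Finset V}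
    (hS : ∀ s ∈ S, G.Dom d s ∨ s ∈ R)
    (hne : ∃ v ∈ S, G.Dom d v ∧ ∀ x ∈ R, ¬ G.Adj v x) :
    ∃ v ∈ S, ∀ u ∈ S, ∀ w ∈ S, G.Conflict v u → G.Conflict v w → G.Conflict u w := by
  classical
  have := Fintype.ofFinite V
  let M : V → Finset V := fun v =>
    Finset.univ.filter fun u => u ∈ R ∧ ∃ x, G.Adj d x ∧ G.Dom x v ∧ G.Adj x u
  have hM : ∀ u v, u ∈ M v ↔ u ∈ R ∧ ∃ x, G.Adj d x ∧ G.Dom x v ∧ G.Adj x u := by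
    simp [M]
  obtain ⟨v, hv, hmin⟩ := Finset.exists_min_image
    (S.filter fun v => G.Dom d v ∧ ∀ x ∈ R, ¬ G.Adj v x) (fun v => (M v).card) (by
      obtain ⟨v, hv⟩ := hne
      exact ⟨v, by simpa using hv⟩)
  obtain ⟨hvS, hdv, hvR⟩ := Finset.mem_filter.1 hv
  -- The sets `M` form a chain, so a smallest one lies in all others: otherwise `u ∈ M v \ M w` and
  -- `t ∈ M w \ M v` with their connectors `x` and `y` would give a chordless 4-cycle `x u t y`.
  have hsub : ∀ w ∈ S, G.Dom d w → (∀ x ∈ R, ¬ G.Adj w x) → M v ⊆ M w := by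
    intro w hwS hdw hwR u hu
    by_contra huw
    have hex : ∃ t ∈ M w, t ∉ M v := by
      by_contra hcon
      push Not at hcon
      exact absurd (hmin w (Finset.mem_filter.2 ⟨hwS, hdw, hwR⟩))
        (not_le.2 (Finset.card_lt_card ⟨hcon, fun e => huw (e hu)⟩))
    obtain ⟨t, htw, htv⟩ := hex
    obtain ⟨huR, x, hdx, hxv, hxu⟩ := (hM _ _).1 hu
    obtain ⟨htR, y, hdy, hyw, hyt⟩ := (hM _ _).1 htw
    have hxt : ¬ G.Adj x t := fun e => htv ((hM _ _).2 ⟨htR, x, hdx, hxv, e⟩)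
    have hyu : ¬ G.Adj y u := fun e => huw ((hM _ _).2 ⟨huR, y, hdy, hyw, e⟩)
    have hxy : G.Adj x y := by
      rcases h.attach_clique hdx hdy huR htR hxu hyt with rfl | e
      · exact absurd hyt hxt
      · exact e
    have hut : G.Adj u t := by
      rcases (h.boundary_dom hdx hdy huR htR hxu hyt).2 with rfl | e
      · exact absurd hxu hxt
      · exact e
    rcases h.chordal.adj_of_square hxu hut hyt.symm hxy.symm
      (fun e => h.not_dom t htR (Or.inr (e ▸ hdx)))
      (fun e => h.not_dom u huR (Or.inr (e ▸ hdy))) with e | e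
    · exact hxt e
    · exact hyu e.symm
  have hcases : ∀ u ∈ S, G.Conflict v u → G.Dom d u ∨ u ∈ M v := by
    intro u hu hvu
    rcases hS u hu with hdu | huR
    · exact Or.inl hdu
    · rcases h.conflict_cases hdv huR hvu with hx | ⟨x, hxR, hvx, -⟩
      · exact Or.inr ((hM _ _).2 ⟨huR, hx⟩)
      · exact absurd hvx (hvR x hxR)
  -- If `u` has no neighbor in `R`, the chain property applies; otherwise `u` belongs to the
  -- attaching clique, which also contains a neighbor `x` of `w`.
  have hmix : ∀ u ∈ S, ∀ w, G.Dom d u → w ∈ M v → G.Conflict u w := by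
    intro u hu w hdu hw
    by_cases huR : ∀ x ∈ R, ¬ G.Adj u x
    · obtain ⟨-, x, -, hxu, hxw⟩ := (hM _ _).1 (hsub u hu hdu huR hw)
      exact ⟨x, hxu, Or.inr hxw⟩
    · push Not at huR
      obtain ⟨b, hb, hub⟩ := huR
      obtain ⟨hwR, x, hdx, -, hxw⟩ := (hM _ _).1 hw
      exact ⟨x, h.attach_clique hdx (h.adj_of_adj hdu hb hub) hwR hb hxw hub, Or.inr hxw⟩
  refine ⟨v, hvS, fun u hu w hw hvu hvw => ?_⟩
  rcases hcases u hu hvu with h1 | h1 <;> rcases hcases w hw hvw with h2 | h2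
  · exact ⟨d, h1, h2⟩
  · exact hmix u hu w h1 h2
  · exact (hmix w hw u h2 h1).symm
  · obtain ⟨huR, x, hdx, -, hxu⟩ := (hM _ _).1 h1
    obtain ⟨hwR, y, hdy, -, hyw⟩ := (hM _ _).1 h2
    exact (h.boundary_dom hdx hdy huR hwR hxu hyw).1

/-- If all vertices of `S ∩ N[d]` have a neighbor in `R`, then one of these is simplicial. -/
theorem exists_simplicial_of_boundary [Finite V] (h : G.StarSide D d R) {S : Finset V}
    (hS : ∀ s ∈ S, G.Dom d s ∨ s ∈ R) (hne : ∃ v ∈ S, G.Dom d v)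
    (hbd : ∀ v ∈ S, G.Dom d v → ∃ x ∈ R, G.Adj v x) :
    ∃ v ∈ S, ∀ u ∈ S, ∀ w ∈ S, G.Conflict v u → G.Conflict v w → G.Conflict u w := by
  classical
  have := Fintype.ofFinite V
  let M : V → Finset V := fun v => Finset.univ.filter fun u => u ∈ R ∧ G.Adj v u
  have hM : ∀ u v, u ∈ M v ↔ u ∈ R ∧ G.Adj v u := by simp [M]
  obtain ⟨v, hv, hmin⟩ := Finset.exists_min_image (S.filter fun v => G.Dom d v)
    (fun v => (M v).card) (by
      obtain ⟨v, hv⟩ := hne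
      exact ⟨v, by simpa using hv⟩)
  obtain ⟨hvS, hdv⟩ := Finset.mem_filter.1 hv
  obtain ⟨b, hb, hvb⟩ := hbd v hvS hdv
  have hdv' : G.Adj d v := h.adj_of_adj hdv hb hvb
  have hnd : ∀ z ∈ R, ∀ y, G.Adj d y → z ≠ y := by
    rintro z hz y hy rfl
    exact h.not_dom z hz (Or.inr hy)
  -- The neighborhoods in `R` again form a chain, as incomparable ones would give a chordless
  -- 4-cycle `v u t w`.
  have hsub : ∀ w ∈ S, G.Dom d w → ∀ u ∈ R, G.Adj v u → G.Adj w u := by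
    intro w hwS hdw u huR hvu
    by_contra hwu
    have hex : ∃ t ∈ M w, t ∉ M v := by
      by_contra hcon
      push Not at hcon
      exact absurd (hmin w (Finset.mem_filter.2 ⟨hwS, hdw⟩))
        (not_le.2 (Finset.card_lt_card
          ⟨hcon, fun e => hwu ((hM _ _).1 (e ((hM _ _).2 ⟨huR, hvu⟩))).2⟩))
    obtain ⟨t, htw, htv⟩ := hex
    obtain ⟨htR, hwt⟩ := (hM _ _).1 htw
    have hvt : ¬ G.Adj v t := fun e => htv ((hM _ _).2 ⟨htR, e⟩)
    have hdw' : G.Adj d w := h.adj_of_adj hdw htR hwt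
    have hvw : G.Adj v w := by
      rcases h.attach_clique hdv' hdw' huR htR hvu hwt with rfl | e
      · exact absurd hwt hvt
      · exact e
    have hut : G.Adj u t := by
      rcases (h.boundary_dom hdv' hdw' huR htR hvu hwt).2 with rfl | e
      · exact absurd hvu hvt
      · exact e
    rcases h.chordal.adj_of_square hvu hut hwt.symm hvw.symm (hnd t htR v hdv').symm
      (hnd u huR w hdw') with e | e
    · exact hvt e
    · exact hwu e.symm
  -- Three kinds of vertices in conflict with `v`: those in `N[d]`, the boundary vertices of `R`,
  -- and the deeper vertices of `R`, reached through a neighbor of `v` in `R`.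
  have hcases : ∀ u ∈ S, G.Conflict v u → G.Dom d u ∨
      (u ∈ R ∧ ∃ x, G.Adj d x ∧ G.Adj x u) ∨
      (u ∈ R ∧ (¬ ∃ x, G.Adj d x ∧ G.Adj x u) ∧ ∃ x ∈ R, G.Adj v x ∧ G.Dom x u) := by
    intro u hu hvu
    rcases hS u hu with hdu | huR
    · exact Or.inl hdu
    · by_cases hex : ∃ x, G.Adj d x ∧ G.Adj x u
      · exact Or.inr (Or.inl ⟨huR, hex⟩)
      · rcases h.conflict_cases hdv huR hvu with ⟨x, h1, -, h2⟩ | hx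
        · exact absurd ⟨x, h1, h2⟩ hex
        · exact Or.inr (Or.inr ⟨huR, hex, hx⟩)
  have hNA : ∀ u ∈ S, ∀ w, G.Dom d u → (w ∈ R ∧ ∃ x, G.Adj d x ∧ G.Adj x w) →
      G.Conflict u w := by
    rintro u hu w hdu ⟨hwR, x, hdx, hxw⟩
    obtain ⟨c, hc, huc⟩ := hbd u hu hdu
    exact ⟨x, h.attach_clique hdx (h.adj_of_adj hdu hc huc) hwR hc hxw huc, Or.inr hxw⟩
  have hNB : ∀ u ∈ S, ∀ w, G.Dom d u → (∃ x ∈ R, G.Adj v x ∧ G.Dom x w) → G.Conflict u w := by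
    rintro u hu w hdu ⟨x, hxR, hvx, hxw⟩
    exact ⟨x, Or.inr (hsub u hu hdu x hxR hvx).symm, hxw⟩
  have hAB : ∀ u w, (u ∈ R ∧ ∃ x, G.Adj d x ∧ G.Adj x u) →
      (∃ x ∈ R, G.Adj v x ∧ G.Dom x w) → G.Conflict u w := by
    rintro u w ⟨huR, y, hdy, hyu⟩ ⟨x, hxR, hvx, hxw⟩
    exact ⟨x, (h.boundary_dom hdv' hdy hxR huR hvx hyu).2, hxw⟩
  refine ⟨v, hvS, fun u hu w hw hvu hvw => ?_⟩
  rcases hcases u hu hvu with h1 | h1 | ⟨huR, hu1, x, hxR, hvx, hxu⟩ <;>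
    rcases hcases w hw hvw with h2 | h2 | ⟨hwR, hw1, y, hyR, hvy, hyw⟩
  · exact ⟨d, h1, h2⟩
  · exact hNA u hu w h1 h2
  · exact hNB u hu w h1 ⟨y, hyR, hvy, hyw⟩
  · exact (hNA w hw u h2 h1).symm
  · obtain ⟨huR, x, hdx, hxu⟩ := h1
    obtain ⟨hwR, y, hdy, hyw⟩ := h2
    exact (h.boundary_dom hdx hdy huR hwR hxu hyw).1
  · exact hAB u w h1 ⟨y, hyR, hvy, hyw⟩
  · exact (hNB w hw u h2 ⟨x, hxR, hvx, hxu⟩).symm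
  · exact (hAB w u h2 ⟨x, hxR, hvx, hxu⟩).symm
  -- Two deep vertices `u`, `w` without a conflict: the triangle `v x y` of `v` and their
  -- connectors, with the pendant vertices `d`, `u`, `w`, is a net.
  · by_contra hcon
    have hyu : ¬ G.Dom y u := fun e => hcon ⟨y, e, hyw⟩
    have hxw : ¬ G.Dom x w := fun e => hcon ⟨x, hxu, e⟩
    have hxu' : G.Adj x u := by
      rcases hxu with rfl | e
      · exact absurd (h.boundary_dom hdv' hdv' hyR hxR hvy hvx).2 hyu
      · exact e
    have hyw' : G.Adj y w := by
      rcases hyw with rfl | e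
      · exact absurd (h.boundary_dom hdv' hdv' hxR hyR hvx hvy).2 hxw
      · exact e
    have hxy : G.Adj x y := by
      rcases (h.boundary_dom hdv' hdv' hxR hyR hvx hvy).2 with rfl | e
      · exact absurd (Or.inr hxu') hyu
      · exact e
    exact h.netFree.not_net hvx hxy hvy hdv'.symm hxu' hyw' (fun e => hu1 ⟨v, hdv', e⟩)
      (fun e => hw1 ⟨v, hdv', e⟩) (fun e => h.not_dom x hxR (Or.inr e.symm))
      (fun e => hxw (Or.inr e)) (fun e => h.not_dom y hyR (Or.inr e.symm))
      (fun e => hyu (Or.inr e)) (fun e => h.not_dom u huR (Or.inr e))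
      (fun e => h.not_dom w hwR (Or.inr e)) (fun e => hcon ⟨u, Dom.refl u, Or.inr e⟩)

end StarSide

theorem Conflict.linked {u w : V} (h : G.Conflict u w) : G.Linked Set.univ u w := by
  obtain ⟨x, hxu, hxw⟩ := h
  have key : ∀ y, G.Dom x y → G.Linked Set.univ x y := by
    rintro y (rfl | e)
    · exact Linked.refl trivial
    · exact e.linked trivial trivial
  exact (key u hxu).symm.trans (key w hxw)

/-- In a net-free chordal graph with an efficient dominating set, every induced subgraph of the
square has a simplicial vertex. -/
theorem exists_simplicial_conflict [Finite V] (hC : IsChordal G) (hN : IsNetFree G) {D : Finset V}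
    (hD : IsEfficientDominating G D) {S : Finset V} (hS : S.Nonempty) :
    ∃ v ∈ S, ∀ u ∈ S, ∀ w ∈ S, G.Conflict v u → G.Conflict v w → G.Conflict u w := by
  classical
  have := Fintype.ofFinite V
  obtain ⟨s₀, hs₀⟩ := hS
  set S' := S.filter fun s => G.Linked Set.univ s₀ s with hS'
  suffices H : ∃ v ∈ S', ∀ u ∈ S', ∀ w ∈ S', G.Conflict v u → G.Conflict v w → G.Conflict u w by
    obtain ⟨v, hv, h⟩ := H
    obtain ⟨hvS, hvl⟩ := Finset.mem_filter.1 hv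
    have hmem : ∀ u ∈ S, G.Conflict v u → u ∈ S' := fun u hu hvu =>
      Finset.mem_filter.2 ⟨hu, hvl.trans hvu.linked⟩
    exact ⟨v, hvS, fun u hu w hw hvu hvw => h u (hmem u hu hvu) w (hmem w hw hvw) hvu hvw⟩
  -- The component of `q.2` in `G - N[q.1]`, empty if `q.1` dominates `q.2`. The pair `(d₀, d₀)`,
  -- with its empty component, only shows that there is a pair to maximize over.
  let R : V × V → Set V := fun q => {z | G.Linked {y | ¬ G.Dom q.1 y} q.2 z}
  obtain ⟨d₀, ⟨hd₀, hds₀⟩, -⟩ := hD s₀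
  obtain ⟨⟨d, r⟩, hdr, hmax⟩ := Finset.exists_max_image
    (Finset.univ.filter fun q : V × V => q.1 ∈ D ∧ ∃ s ∈ S', G.Dom q.1 s)
    (fun q => (S'.filter (· ∈ R q)).card)
    ⟨(d₀, d₀), by
      simp only [Finset.mem_filter, Finset.mem_univ, true_and]
      exact ⟨hd₀, s₀, Finset.mem_filter.2 ⟨hs₀, Linked.refl trivial⟩, hds₀⟩⟩
  simp only [Finset.mem_filter, Finset.mem_univ, true_and] at hdr
  obtain ⟨hd, s₁, hs₁, hds₁⟩ := hdr
  have hside : G.StarSide D d (R (d, r)) :=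
    { chordal := hC
      netFree := hN
      eds := hD
      mem := hd
      not_dom := fun z hz => hz.right_mem
      closed := fun z hz y hzy hy => Linked.trans hz (hzy.linked (Linked.right_mem hz) hy)
      linked := fun z hz y hy =>
        (Linked.linked_component hz).symm.trans (Linked.linked_component hy) }
  -- If `s` is missed, let `d'` be its dominator. The star `N[d']` is connected and disjoint from
  -- `N[d]`, so it avoids `R` too. Hence the component of `d` in `G - N[d']` contains `N[d]` and all
  -- of `S' ∩ R`, thus also `s₁`, contradicting maximality.
  have hcover : ∀ s ∈ S', G.Dom d s ∨ s ∈ R (d, r) := by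
    intro s hs
    by_contra hcon
    push Not at hcon
    obtain ⟨hds, hsR⟩ := hcon
    obtain ⟨d', ⟨hd', hds' : G.Dom d' s⟩, -⟩ := hD s
    have hdd : d ≠ d' := by
      rintro rfl
      exact hds hds'
    have hdisj : ∀ z, G.Dom d z → ¬ G.Dom d' z := fun z h1 h2 => hdd (hD.eq_of_dom hd hd' h1 h2)
    have hstar : ∀ z, G.Dom d z → G.Linked {y | ¬ G.Dom d' y} d z := by
      rintro z (rfl | hz)
      · exact Linked.refl (hdisj d (Dom.refl d))
      · exact hz.linked (hdisj d (Dom.refl d)) (hdisj z (Or.inr hz))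
    have hRd : ∀ z ∈ R (d, r), ¬ G.Dom d' z := by
      intro z hz hdz
      have key : ∀ y, G.Dom d' y → G.Linked {y | ¬ G.Dom d y} d' y := by
        have : ∀ y, G.Dom d' y → ¬ G.Dom d y := fun y h1 h2 => hdisj y h2 h1
        rintro y (rfl | hy)
        · exact Linked.refl (this _ (Dom.refl _))
        · exact hy.linked (this _ (Dom.refl _)) (this _ (Or.inr hy))
      exact hsR (Linked.trans hz ((key z hdz).symm.trans (key s hds')))
    have hd'mem : ((d', d) : V × V) ∈
        Finset.univ.filter fun q : V × V => q.1 ∈ D ∧ ∃ s ∈ S', G.Dom q.1 s := by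
      simp only [Finset.mem_filter, Finset.mem_univ, true_and]
      exact ⟨hd', s, hs, hds'⟩
    refine absurd (hmax _ hd'mem) (not_le.2 (Finset.card_lt_card ⟨?_, ?_⟩))
    · intro z hz
      obtain ⟨hzS, hzR⟩ := Finset.mem_filter.1 hz
      refine Finset.mem_filter.2 ⟨hzS, ?_⟩
      have hzd : G.Linked Set.univ z d := by
        refine (Finset.mem_filter.1 hzS).2.symm.trans ((Finset.mem_filter.1 hs₁).2.trans ?_)
        exact Conflict.linked ⟨d, hds₁, Dom.refl d⟩
      obtain ⟨y, y', -, -, hyy, hy, hy'⟩ := hzd.exists_crossing (· ∈ R (d, r)) hzR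
        (fun e => hside.not_dom d e (Dom.refl d))
      have hdy' : G.Dom d y' := by
        by_contra e
        exact hy' (hside.closed y hy y' hyy e)
      exact (hstar y' hdy').trans ((hyy.symm.linked (hdisj y' hdy') (hRd y hy)).trans
        ((hside.linked y hy z hzR).mono hRd))
    · intro hsub
      have := hsub (Finset.mem_filter.2 ⟨hs₁, hstar s₁ hds₁⟩)
      exact hside.not_dom s₁ (Finset.mem_filter.1 this).2 hds₁
  by_cases hint : ∃ v ∈ S', G.Dom d v ∧ ∀ x ∈ R (d, r), ¬ G.Adj v x
  · exact hside.exists_simplicial_of_interior hcover hint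
  · push Not at hint
    exact hside.exists_simplicial_of_boundary hcover ⟨s₁, hs₁, hds₁⟩ hint

end SimpleGraph

/-! ### The local ratio method for independent sets -/

namespace LocalRatio

open Classical in
/-- The `0`-`1`-matrix of a relation. -/
noncomputable def ind {V : Type*} (H : V → V → Prop) (v u : V) : ℕ := if H v u then 1 else 0

variable {V : Type*} {H : V → V → Prop}

theorem ind_of {v u : V} (h : H v u) : ind H v u = 1 := if_pos h

theorem ind_of_not {v u : V} (h : ¬ H v u) : ind H v u = 0 := if_neg h

theorem ind_le_one (v u : V) : ind H v u ≤ 1 := by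
  unfold ind
  split_ifs <;> omega

/-- Reduce the weights of all `H`-neighbors of `v` by the weight of `v`. -/
noncomputable def reduce (H : V → V → Prop) (r : V → ℕ) (v : V) : V → ℕ :=
  fun u => r u - r v * ind H v u

theorem reduce_le (r : V → ℕ) (v u : V) : reduce H r v u ≤ r u := Nat.sub_le _ _

open Classical in
/-- The local ratio algorithm for independent sets of `H`: reduce the weights along the list, and
then collect, from the end of the list, the vertices that had positive weight. -/
noncomputable def select (H : V → V → Prop) : List V → (V → ℕ) → Finset V
  | [], _ => ∅
  | v :: l, r =>
    if r v ≠ 0 ∧ ∀ u ∈ select H l (reduce H r v), ¬ H v u then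
      insert v (select H l (reduce H r v))
    else select H l (reduce H r v)

theorem mem_select {l : List V} {r : V → ℕ} {x : V} (hx : x ∈ select H l r) :
    r x ≠ 0 := by
  classical
  induction l generalizing r with
  | nil => simp [select] at hx
  | cons v l ih =>
    have key : x ∈ select H l (reduce H r v) → r x ≠ 0 := fun h => by
      have := ih h
      have := reduce_le (H := H) r v x
      omega
    unfold select at hx
    split_ifs at hx with hv
    · rcases Finset.mem_insert.1 hx with rfl | h
      · exact hv.1
      · exact key h
    · exact key hx

/-- No two different vertices of `I` are `H`-adjacent. -/
def Independent (H : V → V → Prop) (I : Finset V) : Prop :=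
  ∀ u ∈ I, ∀ w ∈ I, H u w → u = w

/-- This needs no elimination property of the list, so the output can be trusted even when the
elimination went wrong. -/
theorem independent_select (hsymm : ∀ u w, H u w → H w u) (l : List V) (r : V → ℕ) :
    Independent H (select H l r) := by
  classical
  induction l generalizing r with
  | nil => simp [select, Independent]
  | cons v l ih =>
    unfold select
    split_ifs with hv
    · intro u hu w hw huw
      rcases Finset.mem_insert.1 hu with rfl | hu <;> rcases Finset.mem_insert.1 hw with rfl | hw
      · rfl
      · exact absurd huw (hv.2 w hw)
      · exact absurd (hsymm _ _ huw) (hv.2 u hu)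
      · exact ih _ u hu w hw huw
    · exact ih _

/-- Each vertex of the list is simplicial in the part of `H` that remains when `S` and the earlier
vertices are removed. -/
def Elim (H : V → V → Prop) : Set V → List V → Prop
  | _, [] => True
  | S, v :: l => v ∉ S ∧ (∀ u, u ∉ S → ∀ w, w ∉ S → H v u → H v w → H u w) ∧
      Elim H (insert v S) l

theorem Elim.notMem {S : Set V} {l : List V} (h : Elim H S l) {x : V} (hx : x ∈ l) : x ∉ S := by
  induction l generalizing S with
  | nil => simp at hx
  | cons v l ih =>
    rcases List.mem_cons.1 hx with rfl | hx
    · exact h.1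
    · exact fun hS => ih h.2.2 hx (Set.mem_insert_of_mem _ hS)

theorem Elim.nodup {S : Set V} {l : List V} (h : Elim H S l) : l.Nodup := by
  induction l generalizing S with
  | nil => simp
  | cons v l ih =>
    exact List.nodup_cons.2 ⟨fun hv => h.2.2.notMem hv (Set.mem_insert _ _), ih h.2.2⟩

/-- `Elim` unfolds from the head, whereas the program extends the order at its end. -/
theorem Elim.concat {S : Set V} {l : List V} (h : Elim H S l) {v : V} (hvS : v ∉ S) (hvl : v ∉ l)
    (hv : ∀ u, u ∉ S → u ∉ l → ∀ w, w ∉ S → w ∉ l → H v u → H v w → H u w) :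
    Elim H S (l ++ [v]) := by
  induction l generalizing S with
  | nil => exact ⟨hvS, fun u hu w hw => hv u hu (by simp) w hw (by simp), trivial⟩
  | cons a l ih =>
    simp only [List.mem_cons, not_or] at hvl hv
    refine ⟨h.1, h.2.1, ih h.2.2 ?_ hvl.2 ?_⟩
    · simp [hvS, hvl.1]
    · simp only [Set.mem_insert_iff, not_or]
      exact fun u hu hul w hw hwl => hv u hu.2 ⟨hu.1, hul⟩ w hw.2 ⟨hw.1, hwl⟩

/-- Passing from `r'` back to `r` gains at most `r v` on `I`, because the remaining neighbors of `v`
are a clique and `I` meets it at most once. The selected set gains at least `r v`: it receives `v`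
or already contains a neighbor of `v`. -/
theorem sum_le_sum_select (hrefl : ∀ u, H u u) {S : Set V} {l : List V} (hl : Elim H S l)
    (r : V → ℕ) {I : Finset V} (hI : Independent H I) (hIl : ∀ u ∈ I, u ∈ l) :
    ∑ u ∈ I, r u ≤ ∑ u ∈ select H l r, r u := by
  classical
  induction l generalizing S r I with
  | nil =>
    have : I = ∅ := Finset.eq_empty_of_forall_notMem fun u hu => by simpa using hIl u hu
    simp [this]
  | cons v l ih =>
    set r' := reduce H r v with hr'
    set X := select H l r' with hX
    have hr'v : r' v = 0 := by simp [hr', reduce, ind_of (hrefl v)]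
    have hIS : ∀ u ∈ I, u ∉ S := fun u hu => hl.notMem (hIl u hu)
    have h1 : ∑ u ∈ I, r u ≤ ∑ u ∈ I, r' u + r v := by
      have hle : ∀ u ∈ I, r u ≤ r' u + r v * ind H v u := fun u _ => by
        simp only [hr', reduce]
        omega
      have hcard : ∑ u ∈ I, ind H v u ≤ 1 := by
        simp only [ind, Finset.sum_boole, Nat.cast_id]
        refine Finset.card_le_one.2 fun a ha b hb => ?_
        rw [Finset.mem_filter] at ha hb
        exact hI a ha.1 b hb.1 (hl.2.1 a (hIS a ha.1) b (hIS b hb.1) ha.2 hb.2)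
      calc ∑ u ∈ I, r u ≤ ∑ u ∈ I, (r' u + r v * ind H v u) := Finset.sum_le_sum hle
        _ = ∑ u ∈ I, r' u + r v * ∑ u ∈ I, ind H v u := by
          rw [Finset.sum_add_distrib, Finset.mul_sum]
        _ ≤ ∑ u ∈ I, r' u + r v := by
          have := Nat.mul_le_mul_left (r v) hcard
          omega
    have h2 : ∑ u ∈ I, r' u = ∑ u ∈ I.erase v, r' u := by
      by_cases hv : v ∈ I
      · rw [← Finset.add_sum_erase I r' hv, hr'v, zero_add]
      · rw [Finset.erase_eq_of_notMem hv]
    have h3 : ∑ u ∈ I.erase v, r' u ≤ ∑ u ∈ X, r' u := by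
      refine ih hl.2.2 r' (fun a ha b hb => hI a (Finset.mem_of_mem_erase ha) b
        (Finset.mem_of_mem_erase hb)) fun u hu => ?_
      exact (List.mem_cons.1 (hIl u (Finset.mem_of_mem_erase hu))).resolve_left
        (Finset.ne_of_mem_erase hu)
    have hle : ∑ u ∈ X, r' u ≤ ∑ u ∈ X, r u := Finset.sum_le_sum fun u _ => reduce_le r v u
    have h4 : ∑ u ∈ X, r' u + r v ≤ ∑ u ∈ select H (v :: l) r, r u := by
      unfold select
      rw [← hr', ← hX]
      split_ifs with hv
      · have hvX : v ∉ X := fun h => hv.2 v h (hrefl v)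
        rw [Finset.sum_insert hvX]
        omega
      · by_cases hrv : r v = 0
        · omega
        · push Not at hv
          obtain ⟨u, hu, huv⟩ := hv hrv
          -- A selected vertex has positive reduced weight, so the subtraction at `u` was not
          -- truncated.
          have hru : r' u + r v = r u := by
            have : r' u ≠ 0 := mem_select hu
            simp only [hr', reduce, ind_of huv] at this ⊢
            omega
          have := Finset.sum_le_sum (s := X.erase u) fun x _ => reduce_le (H := H) r v x
          rw [← hr'] at this
          rw [← Finset.add_sum_erase X r hu, ← Finset.add_sum_erase X r' hu]
          omega
    omega

end LocalRatio

/-! ### From efficient domination to independent sets of the square -/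

namespace WED

open SimpleGraph LocalRatio

variable {V : Type*} {G : SimpleGraph V} {w : V → ℕ∞}

theorem weightCode_eq_zero {x : ℕ∞} : weightCode x = 0 ↔ x = ⊤ := by
  cases x with
  | top => exact iff_of_true rfl rfl
  | coe m => exact iff_of_false (Nat.succ_ne_zero m) (ENat.natCast_ne_top m)

theorem eq_weightCode {x : ℕ∞} (hx : weightCode x ≠ 0) : x = ((weightCode x - 1 : ℕ) : ℕ∞) := by
  cases x with
  | top => exact absurd rfl hx
  | coe m => rfl

theorem totalWeight_eq {X : Finset V} (hX : ∀ v ∈ X, w v ≠ ⊤) :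
    totalWeight w X = ((∑ v ∈ X, (weightCode (w v) - 1) : ℕ) : ℕ∞) := by
  rw [totalWeight, Nat.cast_sum]
  exact Finset.sum_congr rfl fun v hv => eq_weightCode fun h => hX v hv (weightCode_eq_zero.1 h)

theorem ne_top_of_totalWeight {X : Finset V} (hX : totalWeight w X ≠ ⊤) : ∀ v ∈ X, w v ≠ ⊤ :=
  fun v hv h => hX (WithTop.sum_eq_top.2 ⟨v, hv, h⟩)

theorem _root_.IsEfficientDominating.independent {D : Finset V} (hD : IsEfficientDominating G D) :
    Independent G.Conflict D := by
  rintro u hu v hv ⟨x, hxu, hxv⟩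
  exact hD.eq_of_dom hu hv hxu.symm hxv.symm

theorem sum_ind_le_one {X : Finset V} (hX : Independent G.Conflict X) (u : V) :
    ∑ v ∈ X, ind G.Dom v u ≤ 1 := by
  classical
  simp only [ind, Finset.sum_boole, Nat.cast_id]
  refine Finset.card_le_one.2 fun a ha b hb => ?_
  rw [Finset.mem_filter] at ha hb
  exact hX a ha.1 b hb.1 ⟨u, ha.2.symm, hb.2.symm⟩

variable [Fintype V] (G) (w)

/-- The number of vertices dominated by `v`. -/
noncomputable def degree (v : V) : ℕ := ∑ u, ind G.Dom v u

/-- A bound on the total weight of all vertices of finite weight. -/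
noncomputable def bigWeight : ℕ := 1 + ∑ v, weightCode (w v)

/-- The weight of a vertex in the independent set problem on the square of `G`. -/
noncomputable def value (v : V) : ℕ :=
  if weightCode (w v) = 0 then 0 else degree G v * bigWeight w + 1 - weightCode (w v)

variable {G w}

theorem degree_pos (v : V) : 0 < degree G v := by
  have : ind G.Dom v v ≤ degree G v :=
    Finset.single_le_sum (f := fun u => ind G.Dom v u) (fun _ _ => Nat.zero_le _)
      (Finset.mem_univ v)
  rw [ind_of (Dom.refl v)] at this
  omega

theorem weightCode_lt_bigWeight (v : V) : weightCode (w v) < bigWeight w := by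
  have := Finset.single_le_sum (f := fun u => weightCode (w u)) (fun _ _ => Nat.zero_le _)
    (Finset.mem_univ v)
  simp only [bigWeight]
  omega

/-- The code of a finite weight is the weight plus one, and it is less than `bigWeight w ≤ degree G
v * bigWeight w`, so the subtraction in `value` is not truncated. -/
theorem value_add {v : V} (hv : w v ≠ ⊤) :
    value G w v ≠ 0 ∧ value G w v + (weightCode (w v) - 1) = degree G v * bigWeight w := by
  have h0 : weightCode (w v) ≠ 0 := fun h => hv (weightCode_eq_zero.1 h)
  have h1 := weightCode_lt_bigWeight (w := w) v
  have h2 : bigWeight w ≤ degree G v * bigWeight w := Nat.le_mul_of_pos_left _ (degree_pos v)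
  simp only [value, h0, if_false]
  omega

theorem ne_top_of_value {v : V} (hv : value G w v ≠ 0) : w v ≠ ⊤ := by
  intro h
  simp [value, weightCode_eq_zero.2 h] at hv

theorem sum_value_add {X : Finset V} (hX : ∀ v ∈ X, w v ≠ ⊤) :
    ∑ v ∈ X, value G w v + ∑ v ∈ X, (weightCode (w v) - 1) =
      (∑ v ∈ X, degree G v) * bigWeight w := by
  rw [← Finset.sum_add_distrib, Finset.sum_mul]
  exact Finset.sum_congr rfl fun v hv => (value_add (hX v hv)).2

theorem sum_weightCode_lt (X : Finset V) : ∑ v ∈ X, (weightCode (w v) - 1) < bigWeight w := by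
  have h1 : ∑ v ∈ X, (weightCode (w v) - 1) ≤ ∑ v ∈ X, weightCode (w v) :=
    Finset.sum_le_sum fun v _ => Nat.sub_le _ _
  have h2 : ∑ v ∈ X, weightCode (w v) ≤ ∑ v, weightCode (w v) :=
    Finset.sum_le_sum_of_subset (Finset.subset_univ X)
  simp only [bigWeight]
  omega

theorem sum_degree_eq (X : Finset V) :
    ∑ v ∈ X, degree G v = ∑ u, ∑ v ∈ X, ind G.Dom v u := Finset.sum_comm

theorem sum_degree_le {X : Finset V} (hX : Independent G.Conflict X) :
    ∑ v ∈ X, degree G v ≤ Fintype.card V := by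
  rw [sum_degree_eq]
  exact (Finset.sum_le_sum fun u _ => sum_ind_le_one hX u).trans (by simp)

/-- Independence in the square says that every vertex is dominated at most once; by double counting,
the degrees add up to the number of vertices exactly when nothing is missed. -/
theorem isEfficientDominating_iff {X : Finset V} (hX : Independent G.Conflict X) :
    IsEfficientDominating G X ↔ ∑ v ∈ X, degree G v = Fintype.card V := by
  classical
  have h1 : ∑ v ∈ X, degree G v = Fintype.card V ↔ ∀ u, ∑ v ∈ X, ind G.Dom v u = 1 := by
    have := Finset.sum_eq_sum_iff_of_le (s := Finset.univ)
      (f := fun u => ∑ v ∈ X, ind G.Dom v u) (g := fun _ => 1) fun u _ => sum_ind_le_one hX u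
    rw [sum_degree_eq]
    simpa using this
  rw [h1]
  refine forall_congr' fun u => ⟨fun h => ?_, fun h => ?_⟩
  · obtain ⟨d, ⟨hd, hdu⟩, -⟩ := h
    have := Finset.single_le_sum (f := fun v => ind G.Dom v u) (fun _ _ => Nat.zero_le _) hd
    rw [ind_of (show G.Dom d u from hdu)] at this
    exact le_antisymm (sum_ind_le_one hX u) this
  · obtain ⟨d, hd, hne⟩ := Finset.exists_ne_zero_of_sum_ne_zero (h.trans_ne one_ne_zero)
    have hdu : G.Dom d u := by
      by_contra e
      exact hne (ind_of_not e)
    exact ⟨d, ⟨hd, hdu⟩, fun e he => hX e he.1 d hd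
      ⟨u, Dom.symm (show G.Dom e u from he.2), hdu.symm⟩⟩

/-- A maximum weight independent set of the square of `G` answers the instance `(G, w)`. -/
theorem isWEDAnswer_of_optimal {X : Finset V} (hX : Independent G.Conflict X)
    (hval : ∀ v ∈ X, value G w v ≠ 0)
    (hopt : (∃ D, IsEfficientDominating G D) → ∀ I, Independent G.Conflict I →
      ∑ v ∈ I, value G w v ≤ ∑ v ∈ X, value G w v) :
    IsWEDAnswer G w (if ∑ v ∈ X, degree G v = Fintype.card V then some X else none) := by
  have hfin : ∀ v ∈ X, w v ≠ ⊤ := fun v hv => ne_top_of_value (hval v hv)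
  have hsum := sum_value_add (G := G) hfin
  split_ifs with hcard
  · have hXe := (isEfficientDominating_iff hX).2 hcard
    refine ⟨hXe, ?_, fun D hD => ?_⟩
    · rw [totalWeight_eq hfin]
      exact ENat.natCast_ne_top _
    · by_cases htop : totalWeight w D = ⊤
      · rw [htop]
        exact le_top
      · have hfinD := ne_top_of_totalWeight htop
        rw [totalWeight_eq hfin, totalWeight_eq hfinD]
        have h1 := hopt ⟨X, hXe⟩ D hD.independent
        have h2 := sum_value_add (G := G) hfinD
        rw [(isEfficientDominating_iff hD.independent).1 hD] at h2
        rw [hcard] at hsum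
        exact_mod_cast (by omega : ∑ v ∈ X, (weightCode (w v) - 1) ≤
          ∑ v ∈ D, (weightCode (w v) - 1))
  · intro D hD
    by_contra htop
    have hfinD := ne_top_of_totalWeight htop
    have h1 := hopt ⟨D, hD⟩ D hD.independent
    have h2 := sum_value_add (G := G) hfinD
    rw [(isEfficientDominating_iff hD.independent).1 hD] at h2
    have h3 := sum_weightCode_lt (w := w) D
    -- Missing one vertex costs `X` a whole `bigWeight w`, more than the total weight of `D`, so `D`
    -- would have the larger value.
    have h4 : (∑ v ∈ X, degree G v) + 1 ≤ Fintype.card V := by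
      have := sum_degree_le hX
      omega
    have h5 := Nat.mul_le_mul_right (bigWeight w) h4
    rw [add_mul, one_mul] at h5
    omega

end WED

/-! ### A program logic for time and overflow -/

namespace RAM

@[simp] theorem State.setReg_arr (s : State) (x v : ℕ) : (s.setReg x v).arr = s.arr := rfl

@[simp] theorem State.setArr_reg (s : State) (a i v : ℕ) : (s.setArr a i v).reg = s.reg := rfl

theorem State.setReg_reg (s : State) (x v y : ℕ) :
    (s.setReg x v).reg y = if y = x then v else s.reg y := by
  simp [State.setReg, Function.update_apply]

theorem State.setArr_arr (s : State) (a i v b : ℕ) :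
    (s.setArr a i v).arr b = if b = a then Function.update (s.arr a) i v else s.arr b := by
  simp [State.setArr, Function.update_apply]

/-- All memory cells hold values up to `Z`. -/
def State.Bounded (Z : ℕ) (s : State) : Prop := (∀ x, s.reg x ≤ Z) ∧ ∀ a i, s.arr a i ≤ Z

/-- An exponent `k` such that the value of the expression is at most `Z ^ k` if all memory cells
are bounded by `Z`. -/
def Expr.valueDeg : Expr → ℕ
  | .const c => max c 1
  | .reg _ => 1
  | .read _ _ => 1
  | .op .add e₁ e₂ => max e₁.valueDeg e₂.valueDeg + 1
  | .op .sub e₁ _ => e₁.valueDeg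
  | .op .mul e₁ e₂ => e₁.valueDeg + e₂.valueDeg
  | .op .lt _ _ => 1
  | .op .eq _ _ => 1

/-- An exponent `k` such that the values of all subexpressions are at most `Z ^ k` if all memory
cells are bounded by `Z`. -/
def Expr.fitDeg : Expr → ℕ
  | .const c => max c 1
  | .reg _ => 1
  | .read _ e => max 1 e.fitDeg
  | .op o e₁ e₂ => max (max e₁.fitDeg e₂.fitDeg) (Expr.op o e₁ e₂).valueDeg

theorem Expr.eval_le {Z : ℕ} (hZ : 2 ≤ Z) {s : State} (hs : s.Bounded Z) (e : Expr) :
    e.eval s ≤ Z ^ e.valueDeg := by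
  induction e with
  | const c =>
    calc c ≤ 2 ^ c := Nat.lt_two_pow_self.le
      _ ≤ Z ^ c := Nat.pow_le_pow_left hZ c
      _ ≤ Z ^ max c 1 := Nat.pow_le_pow_right (by omega) (le_max_left _ _)
  | reg x => simpa [valueDeg, Expr.eval] using hs.1 x
  | read a e => simpa [valueDeg, Expr.eval] using hs.2 a _
  | op o e₁ e₂ h₁ h₂ =>
    cases o with
    | add =>
      have h₃ : Z ^ e₁.valueDeg ≤ Z ^ max e₁.valueDeg e₂.valueDeg :=
        Nat.pow_le_pow_right (by omega) (le_max_left _ _)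
      have h₄ : Z ^ e₂.valueDeg ≤ Z ^ max e₁.valueDeg e₂.valueDeg :=
        Nat.pow_le_pow_right (by omega) (le_max_right _ _)
      have h₅ := Nat.mul_le_mul_left (Z ^ max e₁.valueDeg e₂.valueDeg) hZ
      simp only [Expr.eval, Op.eval, valueDeg, pow_succ]
      omega
    | sub => exact (Nat.sub_le _ _).trans h₁
    | mul =>
      simp only [Expr.eval, Op.eval, valueDeg, pow_add]
      exact Nat.mul_le_mul h₁ h₂
    | lt =>
      simp only [Expr.eval, Op.eval, valueDeg, pow_one]
      split_ifs <;> omega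
    | eq =>
      simp only [Expr.eval, Op.eval, valueDeg, pow_one]
      split_ifs <;> omega

/-- This reduces overflow to a syntactic degree: only stored values need semantic bounds, and
intermediate values get the room up to `Z ^ k`. -/
theorem Expr.fits {Z k : ℕ} (hZ : 2 ≤ Z) {s : State} (hs : s.Bounded Z) (e : Expr)
    (he : e.fitDeg ≤ k) : e.Fits (Z ^ k) s := by
  have hpow : ∀ {j}, j ≤ k → Z ^ j ≤ Z ^ k := fun h => Nat.pow_le_pow_right (by omega) h
  induction e with
  | const c => exact (Expr.eval_le hZ hs (.const c)).trans (hpow he)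
  | reg x => exact (Expr.eval_le hZ hs (.reg x)).trans (hpow he)
  | read a e ih =>
    simp only [fitDeg, max_le_iff] at he
    exact ⟨ih he.2, (Expr.eval_le hZ hs (.read a e)).trans (hpow he.1)⟩
  | op o e₁ e₂ h₁ h₂ =>
    simp only [fitDeg, max_le_iff] at he
    exact ⟨h₁ he.1.1, h₂ he.1.2, (Expr.eval_le hZ hs (.op o e₁ e₂)).trans (hpow he.2)⟩

/-- Programs whose only loops run a register through the numbers below the content of
register `0`. -/
inductive Stm where
  | assign (x : ℕ) (e : Expr)
  | store (a : ℕ) (index e : Expr)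
  | seq (p q : Stm)
  | loop (x : ℕ) (p : Stm)

namespace Stm

def compile : Stm → Prog
  | assign x e => .assign x e
  | store a i e => .store a i e
  | seq p q => .seq p.compile q.compile
  | loop x p => .seq (.assign x (.const 0)) (.while (.op .lt (.reg x) (.reg 0))
      (.seq p.compile (.assign x (.op .add (.reg x) (.const 1)))))

/-- The running time if register `0` holds `n`. -/
def cost (n : ℕ) : Stm → ℕ
  | assign _ e => e.cost + 1
  | store _ i e => i.cost + e.cost + 1
  | seq p q => p.cost n + q.cost n
  -- Two steps reset the counter; each round spends four on the test and four on the increment; the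
  -- failing last test takes four.
  | loop _ p => 2 + (n * (p.cost n + 8) + 4)

def depth : Stm → ℕ
  | assign _ _ => 0
  | store _ _ _ => 0
  | seq p q => max p.depth q.depth
  | loop _ p => p.depth + 1

/-- The coefficient in `cost_le`, where `14 = 2 + 8 + 4` collects the overheads of a loop. -/
def size : Stm → ℕ
  | assign _ e => e.cost + 1
  | store _ i e => i.cost + e.cost + 1
  | seq p q => p.size + q.size
  | loop _ p => p.size + 14

theorem cost_le (n : ℕ) (p : Stm) : p.cost n ≤ p.size * (n + 1) ^ p.depth := by
  have hpow : ∀ {i j}, i ≤ j → (n + 1) ^ i ≤ (n + 1) ^ j := fun h =>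
    Nat.pow_le_pow_right (by omega) h
  induction p with
  | assign x e => simp [cost, size, depth]
  | store a i e => simp [cost, size, depth]
  | seq p q hp hq =>
    simp only [cost, size, depth, add_mul]
    exact add_le_add (hp.trans (Nat.mul_le_mul_left _ (hpow (le_max_left _ _))))
      (hq.trans (Nat.mul_le_mul_left _ (hpow (le_max_right _ _))))
  | loop x p ih =>
    simp only [cost, size, depth, pow_succ]
    have h1 : 1 ≤ (n + 1) ^ p.depth := Nat.one_le_pow _ _ (by omega)
    have h2 := Nat.mul_le_mul_left n ih
    have h3 := Nat.mul_le_mul_left n h1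
    nlinarith

/-- The registers that a program may write. -/
def regs : Stm → List ℕ
  | assign x _ => [x]
  | store _ _ _ => []
  | seq p q => p.regs ++ q.regs
  | loop x p => x :: p.regs

/-- The arrays that a program may write. -/
def arrs : Stm → List ℕ
  | assign _ _ => []
  | store a _ _ => [a]
  | seq p q => p.arrs ++ q.arrs
  | loop _ p => p.arrs

/-- The states agree on everything that the program may not write. -/
structure Frame (p : Stm) (s s' : State) : Prop where
  reg : ∀ x, x ∉ p.regs → s'.reg x = s.reg x
  arr : ∀ a, a ∉ p.arrs → s'.arr a = s.arr a

theorem Frame.trans {p : Stm} {s s' s'' : State} (h : Frame p s s') (h' : Frame p s' s'') :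
    Frame p s s'' :=
  ⟨fun x hx => (h'.reg x hx).trans (h.reg x hx), fun a ha => (h'.arr a ha).trans (h.arr a ha)⟩

end Stm

/-- Register `0` holds `n`, and all memory cells are bounded by `Z`. -/
structure Ok (n Z : ℕ) (s : State) : Prop where
  reg_zero : s.reg 0 = n
  bounded : s.Bounded Z

theorem Ok.setReg {n Z : ℕ} {s : State} (hs : Ok n Z s) {x v : ℕ} (hx : x ≠ 0) (hv : v ≤ Z) :
    Ok n Z (s.setReg x v) := by
  refine ⟨?_, fun y => ?_, hs.bounded.2⟩
  · rw [State.setReg_reg, if_neg hx.symm, hs.reg_zero]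
  · rw [State.setReg_reg]
    split_ifs
    exacts [hv, hs.bounded.1 y]

theorem Ok.setArr {n Z : ℕ} {s : State} (hs : Ok n Z s) {a i v : ℕ} (hv : v ≤ Z) :
    Ok n Z (s.setArr a i v) := by
  refine ⟨hs.reg_zero, hs.bounded.1, fun b j => ?_⟩
  rw [State.setArr_arr]
  split_ifs
  · rw [Function.update_apply]
    split_ifs
    exacts [hv, hs.bounded.2 a j]
  · exact hs.bounded.2 b j

open Stm

/-- Started in `s`, the program `p` halts in time, without overflow, and in a state satisfying
`Q`. -/
def WP (n Z : ℕ) (p : Stm) (s : State) (Q : State → Prop) : Prop :=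
  Ok n Z s → ∃ t s', Run (Z ^ 5) p.compile s t s' ∧ t ≤ p.cost n ∧ p.Frame s s' ∧ Ok n Z s' ∧ Q s'

variable {n Z : ℕ} {s : State} {Q : State → Prop}

theorem WP.conseq {p : Stm} {Q' : State → Prop} (h : WP n Z p s Q)
    (hQ : ∀ s', p.Frame s s' → Ok n Z s' → Q s' → Q' s') : WP n Z p s Q' := by
  intro hs
  obtain ⟨t, s', h1, h2, h3, h4, h5⟩ := h hs
  exact ⟨t, s', h1, h2, h3, h4, hQ s' h3 h4 h5⟩

theorem WP.assign (hZ : 2 ≤ Z) {x : ℕ} {e : Expr} (hx : x ≠ 0) (he : e.fitDeg ≤ 5)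
    (h : Ok n Z s → e.eval s ≤ Z ∧ Q (s.setReg x (e.eval s))) :
    WP n Z (assign x e) s Q := by
  intro hs
  refine ⟨_, _, Run.assign x e s (e.fits hZ hs.bounded he), le_rfl, ⟨fun y hy => ?_, ?_⟩,
    hs.setReg hx (h hs).1, (h hs).2⟩
  · rw [State.setReg_reg, if_neg (by simpa [regs] using hy)]
  · simp

theorem WP.store (hZ : 2 ≤ Z) {a : ℕ} {i e : Expr} (hi : i.fitDeg ≤ 5)
    (he : e.fitDeg ≤ 5) (h : Ok n Z s → e.eval s ≤ Z ∧ Q (s.setArr a (i.eval s) (e.eval s))) :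
    WP n Z (store a i e) s Q := by
  intro hs
  refine ⟨_, _, Run.store a i e s (i.fits hZ hs.bounded hi) (e.fits hZ hs.bounded he), le_rfl,
    ⟨?_, fun b hb => ?_⟩, hs.setArr (h hs).1, (h hs).2⟩
  · simp
  · rw [State.setArr_arr, if_neg (by simpa [arrs] using hb)]

theorem WP.seq {p q : Stm} (h : WP n Z p s fun s' => WP n Z q s' Q) : WP n Z (seq p q) s Q := by
  intro hs
  obtain ⟨t, s', h1, h2, h3, h4, h5⟩ := h hs
  obtain ⟨t', s'', k1, k2, k3, k4, k5⟩ := h5 h4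
  refine ⟨_, s'', Run.seq h1 k1, add_le_add h2 k2, ⟨fun x hx => ?_, fun a ha => ?_⟩, k4, k5⟩
  · simp only [regs, List.mem_append, not_or] at hx
    exact (k3.reg x hx.2).trans (h3.reg x hx.1)
  · simp only [arrs, List.mem_append, not_or] at ha
    exact (k3.arr a ha.2).trans (h3.arr a ha.1)

/-- The invariant speaks of the state after the counter has been set, hence the `setReg`. The
`Frame` hypothesis of a round spares the invariant everything the loop cannot write. -/
theorem WP.loop (hZ : 2 ≤ Z) (hn : n + 1 ≤ Z) {x : ℕ} {p : Stm} (hx : x ≠ 0) (hxp : x ∉ p.regs)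
    (I : ℕ → State → Prop) (h0 : I 0 (s.setReg x 0))
    (hstep : ∀ k < n, ∀ s', (Stm.loop x p).Frame s s' → Ok n Z s' → s'.reg x = k → I k s' →
      WP n Z p s' fun s'' => I (k + 1) (s''.setReg x (k + 1))) :
    WP n Z (Stm.loop x p) s (I n) := by
  intro hs
  have hframe : ∀ (s' : State) (v : ℕ), (Stm.loop x p).Frame s' (s'.setReg x v) := by
    intro s' v
    refine ⟨fun y hy => ?_, fun _ _ => rfl⟩
    simp only [regs, List.mem_cons, not_or] at hy
    rw [State.setReg_reg, if_neg hy.1]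
  have key : ∀ m k s', k + m = n → (Stm.loop x p).Frame s s' → Ok n Z s' → s'.reg x = k → I k s' →
      ∃ t s'', Run (Z ^ 5) (.while (.op .lt (.reg x) (.reg 0))
        (.seq p.compile (.assign x (.op .add (.reg x) (.const 1))))) s' t s'' ∧
        t ≤ m * (p.cost n + 8) + 4 ∧ (Stm.loop x p).Frame s s'' ∧ Ok n Z s'' ∧ I n s'' := by
    intro m
    induction m with
    | zero =>
      intro k s' hk hf hok hxk hI
      obtain rfl : k = n := by omega
      refine ⟨_, s', Run.while_false (Expr.fits hZ hok.bounded _ (by decide : 1 ≤ 5)) ?_,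
        by simp [Expr.cost], hf, hok, hI⟩
      simp [Expr.eval, Op.eval, hxk, hok.reg_zero]
    | succ m ih =>
      intro k s' hk hf hok hxk hI
      obtain ⟨t, s₁, h1, h2, h3, h4, h5⟩ := hstep k (by omega) s' hf hok hxk hI hok
      have hx1 : s₁.reg x = k := (h3.reg x hxp).trans hxk
      have hev : Expr.eval s₁ (.op .add (.reg x) (.const 1)) = k + 1 := by
        simp [Expr.eval, Op.eval, hx1]
      have hf1 : (Stm.loop x p).Frame s (s₁.setReg x (k + 1)) := by
        refine (hf.trans ⟨fun y hy => ?_, h3.arr⟩).trans (hframe _ _)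
        simp only [regs, List.mem_cons, not_or] at hy
        exact h3.reg y hy.2
      obtain ⟨t', s₂, k1, k2, k3, k4, k5⟩ := ih (k + 1) (s₁.setReg x (k + 1)) (by omega) hf1
        (h4.setReg hx (by omega)) (by simp [State.setReg_reg]) h5
      have hrun := Run.while_true (Expr.fits hZ hok.bounded (.op .lt (.reg x) (.reg 0))
        (by decide : 1 ≤ 5))
        (by simp [Expr.eval, Op.eval, hxk, hok.reg_zero]; omega)
        (Run.seq h1 (Run.assign x (.op .add (.reg x) (.const 1)) s₁
          (Expr.fits hZ h4.bounded _ (by decide : 2 ≤ 5)))) (hev ▸ k1)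
      refine ⟨_, s₂, hrun, ?_, k3, k4, k5⟩
      simp only [Expr.cost]
      rw [add_mul]
      omega
  obtain ⟨t, s'', h1, h2, h3, h4, h5⟩ := key n 0 (s.setReg x 0) (by omega) (hframe s 0)
    (hs.setReg hx (by omega)) (by simp [State.setReg_reg]) h0
  refine ⟨_, s'', Run.seq (Run.assign x (.const 0) s
    (Expr.fits hZ hs.bounded _ (by decide : 1 ≤ 5))) h1, ?_, h3, h4, h5⟩
  simp only [Expr.cost, cost]
  omega

/-- The index of the entry `(e₁, e₂)` of a matrix that is stored row by row. -/
def Expr.idx (e₁ e₂ : Expr) : Expr := .op .add (.op .mul e₁ (.reg 0)) e₂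

theorem idx_inj {i j i' j' : ℕ} (hj : j < n) (hj' : j' < n) :
    i * n + j = i' * n + j' ↔ i = i' ∧ j = j' := by
  refine ⟨fun h => ?_, fun h => by rw [h.1, h.2]⟩
  have hi : i = i' := by
    have h1 := congrArg (· / n) h
    rwa [mul_comm i, mul_comm i', Nat.mul_add_div (by omega), Nat.mul_add_div (by omega),
      Nat.div_eq_of_lt hj, Nat.div_eq_of_lt hj', add_zero, add_zero] at h1
  subst hi
  exact ⟨rfl, by omega⟩

/-- Sum up the values of `e` in register `5`, where register `3` runs through the numbers below
the content of register `0`. -/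
def Stm.sum (e : Expr) : Stm :=
  .seq (.assign 5 (.const 0)) (.loop 3 (.assign 5 (.op .add (.reg 5) e)))

theorem WP.sum (hZ : 2 ≤ Z) (hn : n + 1 ≤ Z) {e : Expr}
    (he : (Expr.op .add (.reg 5) e).fitDeg ≤ 5) (f : Fin n → ℕ) (hf : ∑ i, f i ≤ Z)
    (hef : ∀ (k : Fin n) (s' : State), Ok n Z s' → s'.arr = s.arr →
      (∀ x, x ≠ 3 → x ≠ 5 → s'.reg x = s.reg x) → s'.reg 3 = k → e.eval s' = f k) :
    WP n Z (Stm.sum e) s fun s' => s'.reg 5 = ∑ i, f i := by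
  rw [Finset.sum_fin_eq_sum_range] at hf ⊢
  set g : ℕ → ℕ := fun i => if h : i < n then f ⟨i, h⟩ else 0 with hg
  refine WP.seq (WP.assign hZ (by decide) (by decide) fun _ => ⟨Nat.zero_le _, ?_⟩)
  refine WP.loop hZ hn (by decide) (by simp [regs])
    (fun k s' => s'.reg 5 = ∑ i ∈ Finset.range k, g i) (by simp [State.setReg_reg, Expr.eval]) ?_
  intro k hk s' hfr hok hreg hI
  have hval : Expr.eval s' (.op .add (.reg 5) e) = ∑ i ∈ Finset.range (k + 1), g i := by
    have h1 := hef ⟨k, hk⟩ s' hok (by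
        funext a
        exact hfr.arr a (by simp [arrs])) (fun x h3 h5 => by
        rw [hfr.reg x (by simp [regs, h3, h5]), State.setReg_reg, if_neg h5]) hreg
    rw [Finset.sum_range_succ]
    simp only [Expr.eval, Op.eval, hI, h1, hg, hk, dif_pos]
  refine WP.assign hZ (by decide) he fun _ => ⟨?_, ?_⟩
  · rw [hval]
    refine le_trans (Finset.sum_le_sum_of_subset ?_) hf
    exact Finset.range_mono hk
  · simp [State.setReg_reg, hval]

/-- Compute an array entry by entry. -/
def Stm.fillVec (a : ℕ) (p : Stm) (e : Expr) : Stm := .loop 1 (.seq p (.store a (.reg 1) e))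

/-- The entry about to be written is known to hold its initial value, which permits updates in
place. -/
theorem WP.fillVec (hZ : 2 ≤ Z) (hn : n + 1 ≤ Z) {a : ℕ} {p : Stm} {e : Expr}
    (he : e.fitDeg ≤ 5) (hp1 : 1 ∉ p.regs) (ha : a ∉ p.arrs)
    (f : Fin n → ℕ)
    (hef : ∀ (i : Fin n) (s' : State), (Stm.fillVec a p e).Frame s s' → Ok n Z s' →
      s'.arr a i = s.arr a i → s'.reg 1 = i → WP n Z p s' fun s'' => e.eval s'' = f i ∧ f i ≤ Z) :
    WP n Z (Stm.fillVec a p e) s fun s' => ∀ i : Fin n, s'.arr a i = f i := by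
  refine (WP.loop hZ hn (by decide) (by simpa [regs] using hp1)
    (fun k s' => ∀ i : Fin n, s'.arr a i = if i.val < k then f i else s.arr a i) (by simp)
    ?_).conseq ?_
  · intro k hk s' hfr hok hreg hI
    refine WP.seq ((hef ⟨k, hk⟩ s' hfr hok (by simp [hI ⟨k, hk⟩]) hreg).conseq ?_)
    rintro s₁ hfr₁ hok₁ ⟨h1, h2⟩
    refine WP.store hZ (by decide) he fun _ => ⟨h1.trans_le h2, fun i => ?_⟩
    have hreg₁ : s₁.reg 1 = k := (hfr₁.reg 1 hp1).trans hreg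
    simp only [State.setReg_arr, State.setArr_arr, if_true, Function.update_apply, Expr.eval,
      hreg₁, h1, hfr₁.arr a ha, hI i]
    by_cases hik : i.val = k
    · have : i = ⟨k, hk⟩ := Fin.ext hik
      subst this
      simp
    · have : i.val < k + 1 ↔ i.val < k := by omega
      simp [hik, this]
  · intro s' _ _ h i
    simp [h i]

/-- Compute a matrix entry by entry. -/
def Stm.fillMat (a : ℕ) (p : Stm) (e : Expr) : Stm :=
  .loop 1 (.loop 2 (.seq p (.store a (.idx (.reg 1) (.reg 2)) e)))

theorem WP.fillMat (hZ : 2 ≤ Z) (hn : n + 1 ≤ Z) {a : ℕ} {p : Stm} {e : Expr}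
    (he : e.fitDeg ≤ 5) (hp1 : 1 ∉ p.regs) (hp2 : 2 ∉ p.regs)
    (ha : a ∉ p.arrs) (f : Fin n → Fin n → ℕ)
    (hef : ∀ (i j : Fin n) (s' : State), (Stm.fillMat a p e).Frame s s' → Ok n Z s' →
      s'.arr a (i * n + j) = s.arr a (i * n + j) → s'.reg 1 = i → s'.reg 2 = j →
      WP n Z p s' fun s'' => e.eval s'' = f i j ∧ f i j ≤ Z) :
    WP n Z (Stm.fillMat a p e) s fun s' => ∀ i j : Fin n, s'.arr a (i * n + j) = f i j := by
  refine (WP.loop hZ hn (by decide) (by simpa [regs] using hp1)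
    (fun k s' => ∀ i j : Fin n, s'.arr a (i * n + j) =
      if i.val < k then f i j else s.arr a (i * n + j)) (by simp) ?_).conseq ?_
  · intro k hk s' hfr hok hreg hI
    refine (WP.loop hZ hn (by decide) (by simpa [regs] using hp2)
      (fun l s' => ∀ i j : Fin n, s'.arr a (i * n + j) =
        if i.val < k ∨ i.val = k ∧ j.val < l then f i j else s.arr a (i * n + j))
        (by simpa using hI) ?_).conseq ?_
    · intro l hl s₁ hfr₁ hok₁ hreg₁ hJ
      have hs₁1 : s₁.reg 1 = k := (hfr₁.reg 1 (by simpa [regs] using hp1)).trans hreg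
      refine WP.seq ((hef ⟨k, hk⟩ ⟨l, hl⟩ s₁
        ⟨fun x hx => (hfr₁.reg x ?_).trans (hfr.reg x hx),
          fun b hb => (hfr₁.arr b hb).trans (hfr.arr b hb)⟩ hok₁ (by simp [hJ ⟨k, hk⟩ ⟨l, hl⟩])
        hs₁1 hreg₁).conseq ?_)
      · simp only [Stm.fillMat, regs, List.mem_cons, not_or] at hx ⊢
        exact hx.2
      · rintro s₂ hfr₂ hok₂ ⟨h1, h2⟩
        refine WP.store hZ (by decide) he fun _ => ⟨h1.trans_le h2, fun i j => ?_⟩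
        have hs₂1 : s₂.reg 1 = k := (hfr₂.reg 1 hp1).trans hs₁1
        have hs₂2 : s₂.reg 2 = l := (hfr₂.reg 2 hp2).trans hreg₁
        simp only [State.setReg_arr, State.setArr_arr, if_true, Function.update_apply, Expr.eval,
          Expr.idx, Op.eval, hs₂1, hs₂2, hok₂.reg_zero, h1, hfr₂.arr a ha, hJ i j,
          idx_inj j.isLt hl]
        by_cases hij : i.val = k ∧ j.val = l
        · obtain ⟨rfl, rfl⟩ := hij
          simp
        · have : (i.val < k ∨ i.val = k ∧ j.val < l + 1) ↔ (i.val < k ∨ i.val = k ∧ j.val < l) := by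
            omega
          simp only [hij, if_false, this]
    · intro s₁ _ _ hJ i j
      rw [State.setReg_arr, hJ i j]
      have : (i.val < k ∨ i.val = k ∧ j.val < n) ↔ i.val < k + 1 := by
        have := j.isLt
        omega
      simp only [this]
  · intro s' _ _ h i j
    simp [h i j]

end RAM

/-! ### The program and its set-up phase -/

namespace WED

open RAM SimpleGraph LocalRatio

/-- The entry `(i, j)` of the matrix stored in the array `a`. -/
def entry (a : ℕ) (i j : Expr) : Expr := .read a (.idx i j)

/-- The negation of a truth value. -/
def neg (e : Expr) : Expr := .op .sub (.const 1) e

/-- Array `2` becomes the adjacency matrix with ones on the diagonal. -/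
def closeAdjacency : Stm :=
  .fillMat 2 (.assign 5 (.op .add (entry 0 (.reg 1) (.reg 2)) (.op .eq (.reg 1) (.reg 2)))) (.reg 5)

/-- Array `3` becomes the conflict matrix. -/
def computeConflict : Stm :=
  .fillMat 3 (.sum (.op .mul (entry 2 (.reg 3) (.reg 1)) (entry 2 (.reg 3) (.reg 2))))
    (.op .lt (.const 0) (.reg 5))

/-- Array `10` becomes the matrix whose entry `(i, j)` counts the vertices that are in conflict
with `j` and not with `i`. -/
def computeDefect : Stm :=
  .fillMat 10 (.sum (.op .mul (entry 3 (.reg 2) (.reg 3)) (neg (entry 3 (.reg 1) (.reg 3)))))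
    (.reg 5)

/-- The entries of array `9` become the numbers of dominated vertices. -/
def computeDegree : Stm := .fillVec 9 (.sum (entry 2 (.reg 1) (.reg 3))) (.reg 5)

/-- Register `6` becomes a bound on the total weight. -/
def computeBigWeight : Stm :=
  .seq (.sum (.read 1 (.reg 3))) (.assign 6 (.op .add (.const 1) (.reg 5)))

/-- Array `6` becomes the weights in the independent set problem. -/
def computeValue : Stm :=
  .fillVec 6 (.assign 5 (.op .mul (.op .lt (.const 0) (.read 1 (.reg 1)))
    (.op .sub (.op .add (.op .mul (.read 9 (.reg 1)) (.reg 6)) (.const 1)) (.read 1 (.reg 1)))))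
    (.reg 5)

def setup : Stm :=
  .seq closeAdjacency (.seq computeConflict (.seq computeDefect (.seq computeDegree
    (.seq computeBigWeight computeValue))))

/-- The truth value of: vertex `1` is alive, and register `5` is zero. -/
def isGood : Expr := .op .mul (neg (.read 4 (.reg 1))) (.op .eq (.reg 5) (.const 0))

/-- Register `4` becomes an alive vertex without defects, if there is one. -/
def findSimplicial : Stm :=
  .seq (.assign 4 (.const 0)) (.loop 1 (.seq
    (.sum (.op .mul (neg (.read 4 (.reg 3))) (.op .mul (entry 3 (.reg 1) (.reg 3))
      (.op .lt (.const 0) (entry 10 (.reg 3) (.reg 1))))))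
    (.assign 4 (.op .add (.op .mul isGood (.reg 1)) (.op .mul (neg isGood) (.reg 4))))))

/-- Account for the removal of the vertex in register `4` in the defects. -/
def updateDefect : Stm :=
  .fillMat 10 (.assign 5 (.op .sub (entry 10 (.reg 1) (.reg 2))
    (.op .mul (entry 3 (.reg 2) (.reg 4)) (neg (entry 3 (.reg 1) (.reg 4)))))) (.reg 5)

/-- Reduce the weights of the vertices in conflict with the vertex in register `4`. -/
def updateValue : Stm :=
  .fillVec 6 (.assign 5 (.op .sub (.read 6 (.reg 1))
    (.op .mul (.reg 9) (entry 3 (.reg 4) (.reg 1))))) (.reg 5)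

/-- Array `4` marks dead vertices, array `5` records the order and array `7` the value at the time
of elimination. Register `9` saves this value because `updateValue` also overwrites the entry of the
eliminated vertex. -/
def eliminateStep : Stm :=
  .seq findSimplicial (.seq (.store 4 (.reg 4) (.const 1)) (.seq (.store 5 (.reg 8) (.reg 4))
    (.seq (.store 7 (.reg 8) (.read 6 (.reg 4))) (.seq (.assign 9 (.read 6 (.reg 4)))
      (.seq updateDefect updateValue)))))

def eliminate : Stm := .loop 8 eliminateStep

/-- Register `9` runs through the elimination order backwards; array `8` marks the selected
vertices. -/
def selectStep : Stm :=
  .seq (.assign 9 (.op .sub (.op .sub (.reg 0) (.const 1)) (.reg 8)))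
    (.seq (.assign 4 (.read 5 (.reg 9)))
      (.seq (.sum (.op .mul (.read 8 (.reg 3)) (entry 3 (.reg 4) (.reg 3))))
        (.store 8 (.reg 4) (.op .add (.read 8 (.reg 4))
          (.op .mul (.op .lt (.const 0) (.read 7 (.reg 9))) (.op .eq (.reg 5) (.const 0)))))))

def selectAll : Stm := .loop 8 selectStep

def finish : Stm :=
  .seq (.fillVec 0 (.assign 5 (.read 8 (.reg 1))) (.reg 5))
    (.sum (.op .mul (.read 8 (.reg 3)) (.read 9 (.reg 3))))

def algorithm : Stm := .seq setup (.seq eliminate (.seq selectAll finish))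

variable {n Z : ℕ} {G : SimpleGraph (Fin n)} {w : Fin n → ℕ∞} {s : State}

theorem sum_fin_le {f : Fin n → ℕ} (hf : ∀ i, f i ≤ 1) : ∑ i, f i ≤ n :=
  (Finset.sum_le_sum fun i _ => hf i).trans (by simp)

theorem ind_mul_le_one {V : Type*} {H : V → V → Prop} (a b : V) {c : ℕ} (hc : c ≤ 1) :
    ind H a b * c ≤ 1 :=
  Nat.mul_le_mul (ind_le_one a b) hc

theorem degree_le (v : Fin n) : degree G v ≤ n := sum_fin_le fun u => ind_le_one v u

theorem wp_closeAdjacency (hZ : 2 ≤ Z) (hn : n + 1 ≤ Z)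
    (hs : ∀ i j : Fin n, s.arr 0 (i * n + j) = ind G.Adj i j) :
    WP n Z closeAdjacency s fun s' => ∀ i j : Fin n, s'.arr 2 (i * n + j) = ind G.Dom i j := by
  refine WP.fillMat hZ hn (by decide) (by decide) (by decide) (by decide) _ ?_
  intro i j s' hfr hok _ h1 h2
  have hval : ind G.Adj i j + (if i.val = j.val then 1 else 0) = ind G.Dom i j := by
    by_cases hij : i = j
    · subst hij
      simp [ind_of_not (G.irrefl (v := i)), ind_of (Dom.refl (G := G) i)]
    · by_cases hadj : G.Adj i j
      · simp [ind_of hadj, ind_of (show G.Dom i j from Or.inr hadj), Fin.val_inj, hij]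
      · simp [ind_of_not hadj, ind_of_not (show ¬ G.Dom i j from not_or.2 ⟨hij, hadj⟩),
          Fin.val_inj, hij]
  have hle := ind_le_one (H := G.Dom) i j
  refine WP.assign hZ (by decide) (by decide) fun _ => ?_
  simp only [entry, Expr.idx, Expr.eval, Op.eval, h1, h2, hok.reg_zero, hfr.arr 0 (by decide), hs,
    hval, State.setReg_reg, if_true, true_and]
  omega

theorem wp_computeConflict (hZ : 2 ≤ Z) (hn : n + 1 ≤ Z)
    (hs : ∀ i j : Fin n, s.arr 2 (i * n + j) = ind G.Dom i j) :
    WP n Z computeConflict s fun s' =>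
      ∀ i j : Fin n, s'.arr 3 (i * n + j) = ind G.Conflict i j := by
  refine WP.fillMat hZ hn (by decide) (by decide) (by decide) (by decide) _ ?_
  intro i j s' hfr hok _ h1 h2
  have hle : ∑ k, ind G.Dom k i * ind G.Dom k j ≤ n :=
    sum_fin_le fun k => ind_mul_le_one _ _ (ind_le_one _ _)
  refine (WP.sum hZ hn (by decide) (fun k => ind G.Dom k i * ind G.Dom k j) (by omega) ?_).conseq ?_
  · intro k s₁ hok₁ harr hreg h3
    simp only [entry, Expr.idx, Expr.eval, Op.eval, hreg 1 (by decide) (by decide),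
      hreg 2 (by decide) (by decide), h1, h2, h3, hok₁.reg_zero, harr, hfr.arr 2 (by decide), hs]
  · intro s₁ _ _ h
    have hle := ind_le_one (H := G.Conflict) i j
    refine ⟨?_, by omega⟩
    simp only [Expr.eval, Op.eval, h]
    by_cases hc : G.Conflict i j
    · obtain ⟨k, hki, hkj⟩ := hc
      have := Finset.single_le_sum (f := fun k => ind G.Dom k i * ind G.Dom k j)
        (fun _ _ => Nat.zero_le _) (Finset.mem_univ k)
      rw [ind_of ⟨k, hki, hkj⟩, if_pos]
      simp only [ind_of hki, ind_of hkj] at this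
      omega
    · rw [ind_of_not hc, if_neg]
      rw [Finset.sum_eq_zero]
      · omega
      · intro k _
        by_cases hki : G.Dom k i
        · rw [ind_of_not fun hkj : G.Dom k j => hc ⟨k, hki, hkj⟩, mul_zero]
        · rw [ind_of_not hki, zero_mul]

theorem wp_computeDefect (hZ : 2 ≤ Z) (hn : n + 1 ≤ Z)
    (hs : ∀ i j : Fin n, s.arr 3 (i * n + j) = ind G.Conflict i j) :
    WP n Z computeDefect s fun s' => ∀ i j : Fin n, s'.arr 10 (i * n + j) =
      ∑ k, ind G.Conflict j k * (1 - ind G.Conflict i k) := by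
  refine WP.fillMat hZ hn (by decide) (by decide) (by decide) (by decide) _ ?_
  intro i j s' hfr hok _ h1 h2
  have hle : ∑ k, ind G.Conflict j k * (1 - ind G.Conflict i k) ≤ n :=
    sum_fin_le fun k => ind_mul_le_one _ _ (Nat.sub_le _ _)
  refine (WP.sum hZ hn (by decide) _ (hle.trans (by omega)) ?_).conseq ?_
  · intro k s₁ hok₁ harr hreg h3
    simp only [entry, neg, Expr.idx, Expr.eval, Op.eval, hreg 1 (by decide) (by decide),
      hreg 2 (by decide) (by decide), h1, h2, h3, hok₁.reg_zero, harr, hfr.arr 3 (by decide), hs]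
  · intro s₁ _ _ h
    exact ⟨h, by omega⟩

theorem wp_computeDegree (hZ : 2 ≤ Z) (hn : n + 1 ≤ Z)
    (hs : ∀ i j : Fin n, s.arr 2 (i * n + j) = ind G.Dom i j) :
    WP n Z computeDegree s fun s' => ∀ i : Fin n, s'.arr 9 i = degree G i := by
  refine WP.fillVec hZ hn (by decide) (by decide) (by decide) _ ?_
  intro i s' hfr hok _ h1
  have hle := degree_le (G := G) i
  refine (WP.sum hZ hn (by decide) (fun k => ind G.Dom i k) (hle.trans (by omega)) ?_).conseq ?_
  · intro k s₁ hok₁ harr hreg h3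
    simp only [entry, Expr.idx, Expr.eval, Op.eval, hreg 1 (by decide) (by decide), h1, h3,
      hok₁.reg_zero, harr, hfr.arr 2 (by decide), hs]
  · intro s₁ _ _ h
    exact ⟨h, by omega⟩

theorem wp_computeBigWeight (hZ : 2 ≤ Z) (hn : n + 1 ≤ Z) (hw : bigWeight w ≤ Z)
    (hs : ∀ i : Fin n, s.arr 1 i = weightCode (w i)) :
    WP n Z computeBigWeight s fun s' => s'.reg 6 = bigWeight w := by
  unfold bigWeight at hw
  refine WP.seq ((WP.sum hZ hn (by decide) (fun k => weightCode (w k)) (by omega) ?_).conseq ?_)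
  · intro k s₁ hok₁ harr hreg h3
    simp only [Expr.eval, h3, harr, hs]
  · intro s₁ _ _ h
    refine WP.assign hZ (by decide) (by decide) fun _ => ?_
    simp only [Expr.eval, Op.eval, h, State.setReg_reg, if_true, bigWeight, and_true]
    exact hw

theorem wp_computeValue (hZ : 2 ≤ Z) (hn : n + 1 ≤ Z) (hw : n * bigWeight w + 1 ≤ Z)
    (h1 : ∀ i : Fin n, s.arr 1 i = weightCode (w i)) (h9 : ∀ i : Fin n, s.arr 9 i = degree G i)
    (h6 : s.reg 6 = bigWeight w) :
    WP n Z computeValue s fun s' => ∀ i : Fin n, s'.arr 6 i = value G w i := by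
  refine WP.fillVec hZ hn (by decide) (by decide) (by decide) _ ?_
  intro i s' hfr hok _ hi
  have hle : value G w i ≤ Z := by
    have := Nat.mul_le_mul_right (bigWeight w) (degree_le (G := G) i)
    unfold value
    split_ifs <;> omega
  have hval : (if 0 < weightCode (w i) then 1 else 0) *
      (degree G i * bigWeight w + 1 - weightCode (w i)) = value G w i := by
    unfold value
    by_cases h0 : weightCode (w i) = 0
    · simp [h0]
    · simp [h0, Nat.pos_of_ne_zero h0]
  refine WP.assign hZ (by decide) (by decide) fun _ => ?_
  simp only [Expr.eval, Op.eval, hi, hfr.arr 1 (by decide), hfr.arr 9 (by decide),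
    hfr.reg 6 (by decide), h1, h9, h6, hval, State.setReg_reg, if_true, true_and, hle]

/-- The memory after the set-up phase. -/
structure Prepared (G : SimpleGraph (Fin n)) (w : Fin n → ℕ∞) (s : State) : Prop where
  conflict : ∀ i j : Fin n, s.arr 3 (i * n + j) = ind G.Conflict i j
  defect : ∀ i j : Fin n, s.arr 10 (i * n + j) =
    ∑ k, ind G.Conflict j k * (1 - ind G.Conflict i k)
  degree : ∀ i : Fin n, s.arr 9 i = degree G i
  value : ∀ i : Fin n, s.arr 6 i = value G w i
  dead : ∀ i : Fin n, s.arr 4 i = 0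
  chosen : ∀ i : Fin n, s.arr 8 i = 0

theorem wp_setup (hZ : 2 ≤ Z) (hn : n + 1 ≤ Z) (hw : bigWeight w ≤ Z)
    (hnw : n * bigWeight w + 1 ≤ Z) : WP n Z setup (input G w) (Prepared G w) := by
  have hadj : ∀ i j : Fin n, (input G w).arr 0 (i * n + j) = ind G.Adj i j := by
    intro i j
    have : (∃ i' j' : Fin n, i.val * n + j.val = i'.val * n + j'.val ∧ G.Adj i' j') ↔
        G.Adj i j := by
      constructor
      · rintro ⟨i', j', h, hadj⟩
        obtain ⟨h1, h2⟩ := (idx_inj j.isLt j'.isLt).1 h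
        rwa [Fin.ext h1, Fin.ext h2]
      · exact fun h => ⟨i, j, rfl, h⟩
    by_cases h : G.Adj i j
    · rw [ind_of h]
      exact if_pos (this.2 h)
    · rw [ind_of_not h]
      exact if_neg fun e => h (this.1 e)
  have hcode : ∀ i : Fin n, (input G w).arr 1 i = weightCode (w i) := by
    intro i
    simp [input]
  have hzero : ∀ a, 2 ≤ a → ∀ i, (input G w).arr a i = 0 := by
    intro a ha i
    simp [input, show a ≠ 0 by omega, show a ≠ 1 by omega]
  refine WP.seq ((wp_closeAdjacency hZ hn hadj).conseq fun s₁ f₁ _ h₁ => ?_)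
  refine WP.seq ((wp_computeConflict hZ hn h₁).conseq fun s₂ f₂ _ h₂ => ?_)
  refine WP.seq ((wp_computeDefect hZ hn h₂).conseq fun s₃ f₃ _ h₃ => ?_)
  refine WP.seq ((wp_computeDegree (G := G) hZ hn ?_).conseq fun s₄ f₄ _ h₄ => ?_)
  · rw [f₃.arr 2 (by decide), f₂.arr 2 (by decide)]
    exact h₁
  refine WP.seq ((wp_computeBigWeight (w := w) hZ hn hw ?_).conseq fun s₅ f₅ _ h₅ => ?_)
  · rw [f₄.arr 1 (by decide), f₃.arr 1 (by decide), f₂.arr 1 (by decide), f₁.arr 1 (by decide)]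
    exact hcode
  refine (wp_computeValue (G := G) (w := w) hZ hn hnw ?_ ?_ h₅).conseq fun s₆ f₆ _ h₆ => ?_
  · rw [f₅.arr 1 (by decide), f₄.arr 1 (by decide), f₃.arr 1 (by decide), f₂.arr 1 (by decide),
      f₁.arr 1 (by decide)]
    exact hcode
  · rw [f₅.arr 9 (by decide)]
    exact h₄
  refine ⟨?_, ?_, ?_, h₆, fun i => ?_, fun i => ?_⟩
  · rw [f₆.arr 3 (by decide), f₅.arr 3 (by decide), f₄.arr 3 (by decide), f₃.arr 3 (by decide)]
    exact h₂
  · rw [f₆.arr 10 (by decide), f₅.arr 10 (by decide), f₄.arr 10 (by decide)]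
    exact h₃
  · rw [f₆.arr 9 (by decide), f₅.arr 9 (by decide)]
    exact h₄
  · rw [f₆.arr 4 (by decide), f₅.arr 4 (by decide), f₄.arr 4 (by decide), f₃.arr 4 (by decide),
      f₂.arr 4 (by decide), f₁.arr 4 (by decide), hzero 4 (by decide)]
  · rw [f₆.arr 8 (by decide), f₅.arr 8 (by decide), f₄.arr 8 (by decide), f₃.arr 8 (by decide),
      f₂.arr 8 (by decide), f₁.arr 8 (by decide), hzero 8 (by decide)]

end WED

/-! ### Correctness of elimination and selection, and the time bound -/

namespace WED

open RAM SimpleGraph LocalRatio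

variable {n Z : ℕ} {G : SimpleGraph (Fin n)} {w : Fin n → ℕ∞} {s : State}

/-- Here `d` marks the dead vertices and `C` is the defect matrix; `F i` counts the alive neighbors
of `i` with a defect. If no vertex qualifies, register `4` keeps its default `0`, and nothing is
claimed about that vertex. -/
theorem wp_findSimplicial (hZ : 2 ≤ Z) (hn : n + 1 ≤ Z) (hpos : 0 < n) (d : Fin n → ℕ)
    (C : Fin n → Fin n → ℕ) (h3 : ∀ i j : Fin n, s.arr 3 (i * n + j) = ind G.Conflict i j)
    (h4 : ∀ i : Fin n, s.arr 4 i = d i) (h10 : ∀ i j : Fin n, s.arr 10 (i * n + j) = C i j) :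
    WP n Z findSimplicial s fun s' => ∃ v : Fin n, s'.reg 4 = v ∧
      ((∃ i, d i = 0 ∧ ∀ k, d k = 0 → G.Conflict i k → C k i = 0) →
        d v = 0 ∧ ∀ k, d k = 0 → G.Conflict v k → C k v = 0) := by
  set F : Fin n → ℕ := fun i =>
    ∑ k, (1 - d k) * (ind G.Conflict i k * if 0 < C k i then 1 else 0) with hF
  have hFle : ∀ i, F i ≤ n := fun i => sum_fin_le fun k =>
    Nat.mul_le_mul (Nat.sub_le 1 _) (ind_mul_le_one (c := if 0 < C k i then 1 else 0) i k
      (by split_ifs <;> omega))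
  have hF0 : ∀ i, F i = 0 ↔ ∀ k, d k = 0 → G.Conflict i k → C k i = 0 := by
    intro i
    rw [hF]
    simp only [Finset.sum_eq_zero_iff, Finset.mem_univ, forall_const]
    refine forall_congr' fun k => ⟨fun h hd hc => ?_, fun h => ?_⟩
    · rw [hd, ind_of hc] at h
      by_contra h0
      simp [Nat.pos_of_ne_zero h0] at h
    · by_cases hd : d k = 0
      · by_cases hc : G.Conflict i k
        · simp [h hd hc]
        · simp [ind_of_not hc]
      · simp [show 1 - d k = 0 by omega]
  simp only [← hF0]
  refine WP.seq (WP.assign hZ (by decide) (by decide) fun _ => ⟨Nat.zero_le _, ?_⟩)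
  refine (WP.loop hZ hn (by decide) (by decide) (fun k s' => ∃ v : Fin n, s'.reg 4 = v ∧
    ((∃ i : Fin n, i.val < k ∧ d i = 0 ∧ F i = 0) → d v = 0 ∧ F v = 0))
    ⟨⟨0, hpos⟩, by simp [State.setReg_reg, Expr.eval], by simp⟩ ?_).conseq ?_
  · rintro k hk s₁ hfr₁ hok₁ h1 ⟨v, hv, hgood⟩
    refine WP.seq ((WP.sum hZ hn (by decide)
      (fun j => (1 - d j) * (ind G.Conflict (⟨k, hk⟩ : Fin n) j * if 0 < C j ⟨k, hk⟩ then 1 else 0))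
      ((hFle ⟨k, hk⟩).trans (by omega)) ?_).conseq ?_)
    · intro j s₂ hok₂ harr hreg hj
      have e3 := h3 ⟨k, hk⟩ j
      have e10 := h10 j ⟨k, hk⟩
      simp only at e3 e10
      simp only [entry, neg, Expr.idx, Expr.eval, Op.eval, hreg 1 (by decide) (by decide), h1, hj,
        hok₂.reg_zero, harr, hfr₁.arr 3 (by decide), hfr₁.arr 4 (by decide),
        hfr₁.arr 10 (by decide), State.setReg_arr, e3, e10, h4]
    · intro s₂ hfr₂ hok₂ h5
      have e4 := h4 ⟨k, hk⟩
      simp only at e4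
      have hF' : s₂.reg 5 = F ⟨k, hk⟩ := h5
      have hval : (Expr.op .add (.op .mul isGood (.reg 1))
          (.op .mul (neg isGood) (.reg 4))).eval s₂ =
          if d ⟨k, hk⟩ = 0 ∧ F ⟨k, hk⟩ = 0 then k else v.val := by
        simp only [isGood, neg, Expr.eval, Op.eval, hfr₂.reg 1 (by decide), h1, hF',
          hfr₂.reg 4 (by decide), hv, hfr₂.arr 4 (by decide), hfr₁.arr 4 (by decide),
          State.setReg_arr, e4]
        by_cases hd : d ⟨k, hk⟩ = 0
        · by_cases hf : F ⟨k, hk⟩ = 0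
          · simp [hd, hf]
          · simp [hd, hf]
        · simp [hd, show 1 - d ⟨k, hk⟩ = 0 by omega]
      refine WP.assign hZ (by decide) (by decide) fun _ => ?_
      rw [hval]
      refine ⟨?_, ?_⟩
      · have := v.isLt
        split_ifs <;> omega
      · by_cases hg : d ⟨k, hk⟩ = 0 ∧ F ⟨k, hk⟩ = 0
        · rw [if_pos hg]
          exact ⟨⟨k, hk⟩, by simp [State.setReg_reg], fun _ => hg⟩
        · rw [if_neg hg]
          refine ⟨v, by simp [State.setReg_reg], ?_⟩
          rintro ⟨i, hi, hgi⟩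
          refine hgood ⟨i, ?_, hgi⟩
          rcases Nat.lt_succ_iff_lt_or_eq.1 hi with h | h
          · exact h
          · exact absurd hgi (by rwa [show i = ⟨k, hk⟩ from Fin.ext h])
  · rintro s' - - ⟨v, hv, hgood⟩
    exact ⟨v, hv, fun ⟨i, hi⟩ => hgood ⟨i, i.isLt, hi⟩⟩

theorem wp_updateDefect (hZ : 2 ≤ Z) (hn : n + 1 ≤ Z) (v : Fin n) (C : Fin n → Fin n → ℕ)
    (h3 : ∀ i j : Fin n, s.arr 3 (i * n + j) = ind G.Conflict i j)
    (h10 : ∀ i j : Fin n, s.arr 10 (i * n + j) = C i j) (h4 : s.reg 4 = v) :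
    WP n Z updateDefect s fun s' => ∀ i j : Fin n, s'.arr 10 (i * n + j) =
      C i j - ind G.Conflict j v * (1 - ind G.Conflict i v) := by
  refine WP.fillMat hZ hn (by decide) (by decide) (by decide) (by decide) _ ?_
  intro i j s' hfr hok h10' h1 h2
  rw [h10] at h10'
  have hle : C i j ≤ Z := h10' ▸ hok.bounded.2 _ _
  refine WP.assign hZ (by decide) (by decide) fun _ => ?_
  simp only [entry, neg, Expr.idx, Expr.eval, Op.eval, h1, h2, hok.reg_zero, hfr.arr 3 (by decide),
    hfr.reg 4 (by decide), h3, h4, h10', State.setReg_reg, if_true, true_and, and_self]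
  omega

theorem wp_updateValue (hZ : 2 ≤ Z) (hn : n + 1 ≤ Z) (v : Fin n) (r : Fin n → ℕ)
    (h3 : ∀ i j : Fin n, s.arr 3 (i * n + j) = ind G.Conflict i j)
    (h6 : ∀ i : Fin n, s.arr 6 i = r i) (h4 : s.reg 4 = v) (h9 : s.reg 9 = r v) :
    WP n Z updateValue s fun s' => ∀ i : Fin n, s'.arr 6 i = reduce G.Conflict r v i := by
  refine WP.fillVec hZ hn (by decide) (by decide) (by decide) _ ?_
  intro i s' hfr hok h6' h1
  rw [h6] at h6'
  have hle : r i ≤ Z := h6' ▸ hok.bounded.2 _ _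
  refine WP.assign hZ (by decide) (by decide) fun _ => ?_
  simp only [entry, Expr.idx, Expr.eval, Op.eval, h1, hok.reg_zero, hfr.arr 3 (by decide),
    hfr.reg 4 (by decide), hfr.reg 9 (by decide), h3, h4, h6', h9, State.setReg_reg, if_true,
    true_and, and_self, reduce]
  omega

/-- The memory after the vertices in the list `l` have been eliminated. -/
structure Eliminated (G : SimpleGraph (Fin n)) (w : Fin n → ℕ∞) (l : List (Fin n)) (s : State) :
    Prop where
  order : ∀ (i : ℕ) (hi : i < l.length), s.arr 5 i = l[i]
  reduction : ∀ (i : ℕ) (hi : i < l.length),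
    s.arr 7 i = (l.take i).foldl (reduce G.Conflict) (value G w) l[i]
  value : ∀ i : Fin n, s.arr 6 i = l.foldl (reduce G.Conflict) (value G w) i
  dead : ∀ i : Fin n, s.arr 4 i = if i ∈ l then 1 else 0
  -- Without an e.d.s. the search may fail and a vertex may be eliminated twice, so the defects and
  -- the order are controlled only conditionally.
  defect : (∃ D, IsEfficientDominating G D) → ∀ i j : Fin n, s.arr 10 (i * n + j) =
    ∑ k, if k ∈ l then 0 else ind G.Conflict j k * (1 - ind G.Conflict i k)
  elim : (∃ D, IsEfficientDominating G D) → Elim G.Conflict ∅ l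

theorem defect_eq_zero_iff {l : List (Fin n)} (i j : Fin n) :
    (∑ k, if k ∈ l then 0 else ind G.Conflict j k * (1 - ind G.Conflict i k)) = 0 ↔
      ∀ k, k ∉ l → G.Conflict j k → G.Conflict i k := by
  simp only [Finset.sum_eq_zero_iff, Finset.mem_univ, forall_const]
  refine forall_congr' fun k => ⟨fun h hk hj => ?_, fun h => ?_⟩
  · by_contra hi
    simp [hk, ind_of hj, ind_of_not hi] at h
  · split_ifs with hk
    · rfl
    · by_cases hj : G.Conflict j k
      · simp [ind_of (h hk hj)]
      · simp [ind_of_not hj]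

theorem wp_eliminateStep (hZ : 2 ≤ Z) (hn : n + 1 ≤ Z) (hC : IsChordal G) (hN : IsNetFree G)
    {t : ℕ} (ht : t < n) (h3 : ∀ i j : Fin n, s.arr 3 (i * n + j) = ind G.Conflict i j)
    (h8 : s.reg 8 = t) {l : List (Fin n)} (hlen : l.length = t) (hl : Eliminated G w l s) :
    WP n Z eliminateStep s fun s' =>
      ∃ l : List (Fin n), l.length = t + 1 ∧ Eliminated G w l s' := by
  refine WP.seq ((wp_findSimplicial (G := G) hZ hn (by omega) (fun i => if i ∈ l then 1 else 0)
    (fun i j => s.arr 10 (i * n + j)) h3 hl.dead fun _ _ => rfl).conseq ?_)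
  rintro s₁ f₁ - ⟨v, hv, hgood⟩
  have hsimp : (∃ D, IsEfficientDominating G D) → v ∉ l ∧
      ∀ u, u ∉ l → ∀ x, x ∉ l → G.Conflict v u → G.Conflict v x → G.Conflict u x := by
    intro hD
    have hd : ∀ i, (if i ∈ l then 1 else 0) = 0 ↔ i ∉ l := by simp
    simp only [hl.defect hD, defect_eq_zero_iff, hd] at hgood
    have hex : ∃ i, i ∉ l ∧ ∀ k, k ∉ l → G.Conflict i k →
        ∀ m, m ∉ l → G.Conflict i m → G.Conflict k m := by
      obtain ⟨D, hD⟩ := hD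
      -- Only `t < n` vertices have been eliminated, so some vertex is alive.
      have hne : (Finset.univ \ l.toFinset).Nonempty := by
        rw [Finset.sdiff_nonempty]
        intro hsub
        have h1 := Finset.card_le_card hsub
        have h2 := l.toFinset_card_le
        simp only [Finset.card_univ, Fintype.card_fin] at h1
        omega
      obtain ⟨i, hi, h⟩ := exists_simplicial_conflict hC hN hD hne
      simp only [Finset.mem_sdiff, Finset.mem_univ, true_and, List.mem_toFinset] at hi h
      exact ⟨i, hi, fun k hk hik m hm him => h k hk m hm hik him⟩
    obtain ⟨h1, h2⟩ := hgood hex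
    exact ⟨h1, fun u hu x hx hvu hvx => h2 u hu hvu x hx hvx⟩
  have hs₁8 : s₁.reg 8 = t := (f₁.reg 8 (by decide)).trans h8
  refine WP.seq (WP.store hZ (by decide) (by decide) fun _ => ⟨by simp [Expr.eval]; omega, ?_⟩)
  refine WP.seq (WP.store hZ (by decide) (by decide) fun _ =>
    ⟨by simp only [Expr.eval, State.setArr_reg, hv]; omega, ?_⟩)
  refine WP.seq (WP.store hZ (by decide) (by decide) fun hok => ⟨hok.bounded.2 _ _, ?_⟩)
  refine WP.seq (WP.assign hZ (by decide) (by decide) fun hok => ⟨hok.bounded.2 _ _, ?_⟩)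
  set r := l.foldl (reduce G.Conflict) (value G w) with hr
  have hs₁6 : s₁.arr 6 v = r v := by rw [f₁.arr 6 (by decide), hl.value]
  simp only [Expr.eval, State.setArr_reg, State.setArr_arr, hv, hs₁8, hs₁6,
    show (6 : ℕ) ≠ 4 by decide, show (6 : ℕ) ≠ 5 by decide, show (6 : ℕ) ≠ 7 by decide, if_false]
  set s₂ := (((s₁.setArr 4 v 1).setArr 5 t v).setArr 7 t (r v)).setReg 9 (r v) with hs₂
  have harr₂ : ∀ a, a ≠ 4 → a ≠ 5 → a ≠ 7 → s₂.arr a = s₁.arr a := by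
    intro a h4 h5 h7
    simp [hs₂, State.setArr_arr, h4, h5, h7]
  have hs₂4 : s₂.reg 4 = v := by simp [hs₂, State.setReg_reg, hv]
  have hs₂9 : s₂.reg 9 = r v := by simp [hs₂, State.setReg_reg]
  have hs₂3 : ∀ i j : Fin n, s₂.arr 3 (i * n + j) = ind G.Conflict i j := by
    intro i j
    rw [harr₂ 3 (by decide) (by decide) (by decide), f₁.arr 3 (by decide), h3]
  refine WP.seq ((wp_updateDefect (G := G) hZ hn v (fun i j => s.arr 10 (i * n + j)) hs₂3 ?_
    hs₂4).conseq fun s₃ f₃ _ hs₃10 => ?_)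
  · intro i j
    rw [harr₂ 10 (by decide) (by decide) (by decide), f₁.arr 10 (by decide)]
  refine (wp_updateValue (G := G) hZ hn v r ?_ ?_ ?_ ?_).conseq fun s₄ f₄ _ hs₄6 => ?_
  · intro i j
    rw [f₃.arr 3 (by decide), hs₂3]
  · intro i
    rw [f₃.arr 6 (by decide), harr₂ 6 (by decide) (by decide) (by decide), f₁.arr 6 (by decide),
      hl.value]
  · rw [f₃.reg 4 (by decide), hs₂4]
  · rw [f₃.reg 9 (by decide), hs₂9]
  have harr : ∀ a, a ≠ 6 → a ≠ 10 → s₄.arr a = s₂.arr a := fun a h6 h10 => by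
    rw [f₄.arr a (by simpa [Stm.arrs, updateValue, Stm.fillVec] using h6),
      f₃.arr a (by simpa [Stm.arrs, updateDefect, Stm.fillMat] using h10)]
  have hs₄5 : s₄.arr 5 = Function.update (s.arr 5) t v := by
    rw [harr 5 (by decide) (by decide)]
    simp [hs₂, State.setArr_arr, f₁.arr 5 (by decide)]
  have hs₄7 : s₄.arr 7 = Function.update (s.arr 7) t (r v) := by
    rw [harr 7 (by decide) (by decide)]
    simp [hs₂, State.setArr_arr, f₁.arr 7 (by decide)]
  have hs₄4 : s₄.arr 4 = Function.update (s.arr 4) v 1 := by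
    rw [harr 4 (by decide) (by decide)]
    simp [hs₂, State.setArr_arr, f₁.arr 4 (by decide)]
  refine ⟨l ++ [v], by simp [hlen], ?_, ?_, ?_, ?_, ?_, ?_⟩
  · intro i hi
    rw [hs₄5]
    rcases Nat.lt_or_ge i t with h | h
    · rw [Function.update_of_ne (by omega), hl.order i (by omega),
        List.getElem_append_left (by omega)]
    · have : i = t := by
        simp only [List.length_append, List.length_singleton] at hi
        omega
      subst this
      simp [hlen]
  · intro i hi
    rw [hs₄7]
    rcases Nat.lt_or_ge i t with h | h
    · rw [Function.update_of_ne (by omega), hl.reduction i (by omega),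
        List.getElem_append_left (by omega), List.take_append_of_le_length (by omega)]
    · have : i = t := by
        simp only [List.length_append, List.length_singleton] at hi
        omega
      subst this
      simp [← hlen, hr]
  · intro i
    rw [hs₄6 i, List.foldl_append]
    rfl
  · intro i
    rw [hs₄4, Function.update_apply, hl.dead]
    by_cases hi : i = v
    · simp [hi]
    · simp [hi, Fin.val_inj]
  · intro hD i j
    have hvl := (hsimp hD).1
    rw [f₄.arr 10 (by decide), hs₃10 i j, hl.defect hD]
    -- As `v` was alive, its term occurs in the old sum, so the truncated subtraction removes
    -- exactly this term.
    have hsplit : ∀ k, (if k ∈ l then 0 else ind G.Conflict j k * (1 - ind G.Conflict i k)) =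
        (if k ∈ l ++ [v] then 0 else ind G.Conflict j k * (1 - ind G.Conflict i k)) +
        if k = v then ind G.Conflict j k * (1 - ind G.Conflict i k) else 0 := by
      intro k
      by_cases hk : k = v
      · subst hk
        simp [hvl]
      · simp [hk]
    rw [Finset.sum_congr rfl fun k _ => hsplit k, Finset.sum_add_distrib, Finset.sum_ite_eq']
    simp
  · intro hD
    obtain ⟨h1, h2⟩ := hsimp hD
    exact (hl.elim hD).concat (by simp) h1 fun u _ hu x _ hx => h2 u hu x hx

theorem wp_eliminate (hZ : 2 ≤ Z) (hn : n + 1 ≤ Z) (hC : IsChordal G) (hN : IsNetFree G)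
    (hs : Prepared G w s) : WP n Z eliminate s fun s' =>
      ∃ l : List (Fin n), l.length = n ∧ Eliminated G w l s' := by
  refine WP.loop hZ hn (by decide) (by decide)
    (fun t s' => ∃ l : List (Fin n), l.length = t ∧ Eliminated G w l s') ?_ ?_
  · refine ⟨[], rfl, by simp, by simp, ?_, ?_, fun _ => ?_, fun _ => trivial⟩
    · simpa using hs.value
    · simpa using hs.dead
    · simpa using hs.defect
  · rintro t ht s₁ f₁ - h8 ⟨l, hlen, hl⟩
    refine (wp_eliminateStep hZ hn hC hN ht ?_ h8 hlen hl).conseq ?_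
    · rw [f₁.arr 3 (by decide)]
      exact hs.conflict
    · rintro s₂ - - ⟨l, hlen, h⟩
      exact ⟨l, hlen, ⟨h.order, h.reduction, h.value, h.dead, h.defect, h.elim⟩⟩

open Classical in
theorem wp_selectStep (hZ : 2 ≤ Z) (hn : n + 1 ≤ Z)
    (h3 : ∀ i j : Fin n, s.arr 3 (i * n + j) = ind G.Conflict i j) {X : Finset (Fin n)}
    (hX : ∀ i : Fin n, s.arr 8 i = if i ∈ X then 1 else 0) {t m c : ℕ} (ht : s.reg 8 = t)
    (hm : n - 1 - t = m) (v : Fin n) (h5 : s.arr 5 m = v) (h7 : s.arr 7 m = c) :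
    WP n Z selectStep s fun s' => ∀ i : Fin n, s'.arr 8 i =
      if i ∈ (if c ≠ 0 ∧ ∀ u ∈ X, ¬ G.Conflict v u then insert v X else X) then 1 else 0 := by
  have hmn : m ≤ n := by omega
  refine WP.seq (WP.assign hZ (by decide) (by decide) fun hok => ?_)
  simp only [Expr.eval, Op.eval, hok.reg_zero, ht, hm]
  refine ⟨by omega, WP.seq (WP.assign hZ (by decide) (by decide) fun hok =>
    ⟨hok.bounded.2 _ _, ?_⟩)⟩
  simp only [Expr.eval, State.setReg_arr, State.setReg_reg, if_true, h5]
  set s₂ := (s.setReg 9 m).setReg 4 v with hs₂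
  have hs₂4 : s₂.reg 4 = v := by simp [hs₂, State.setReg_reg]
  have hs₂9 : s₂.reg 9 = m := by simp [hs₂, State.setReg_reg]
  have harr₂ : s₂.arr = s.arr := rfl
  clear_value s₂
  have hle : ∀ k, (if k ∈ X then 1 else 0) * ind G.Conflict v k ≤ 1 := fun k => by
    rw [mul_comm]
    exact ind_mul_le_one v k (by split_ifs <;> omega)
  refine WP.seq ((WP.sum hZ hn (by decide) (fun k => (if k ∈ X then 1 else 0) * ind G.Conflict v k)
    ((sum_fin_le hle).trans (by omega)) ?_).conseq ?_)
  · intro k s₃ hok₃ harr hreg hk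
    simp only [entry, Expr.idx, Expr.eval, Op.eval, hreg 4 (by decide) (by decide), hs₂4, hk,
      hok₃.reg_zero, harr, harr₂, hX k, h3]
  · intro s₃ f₃ hok₃ hsum
    have hblock : s₃.reg 5 = 0 ↔ ∀ u ∈ X, ¬ G.Conflict v u := by
      rw [hsum]
      simp only [Finset.sum_eq_zero_iff, Finset.mem_univ, forall_const]
      refine forall_congr' fun u => ?_
      by_cases hu : u ∈ X
      · by_cases hc : G.Conflict v u
        · simp [hu, hc, ind_of hc]
        · simp [hc, ind_of_not hc]
      · simp [hu]
    have h8 : s₃.arr 8 = s.arr 8 := by rw [f₃.arr 8 (by decide), harr₂]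
    have h7' : s₃.arr 7 m = c := by rw [f₃.arr 7 (by decide), harr₂, h7]
    have h4 : s₃.reg 4 = v := by rw [f₃.reg 4 (by decide), hs₂4]
    have h9 : s₃.reg 9 = m := by rw [f₃.reg 9 (by decide), hs₂9]
    have hval : (Expr.op .add (.read 8 (.reg 4))
        (.op .mul (.op .lt (.const 0) (.read 7 (.reg 9))) (.op .eq (.reg 5) (.const 0)))).eval s₃ =
        if v ∈ (if c ≠ 0 ∧ ∀ u ∈ X, ¬ G.Conflict v u then insert v X else X) then 1 else 0 := by
      simp only [Expr.eval, Op.eval, h4, h9, h8, h7', hX v]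
      by_cases hc : c = 0
      · simp [hc]
      · by_cases hb : ∀ u ∈ X, ¬ G.Conflict v u
        · have hvX : v ∉ X := fun h => hb v h ⟨v, Dom.refl v, Dom.refl v⟩
          have hcond : c ≠ 0 ∧ ∀ u ∈ X, ¬ G.Conflict v u := ⟨hc, hb⟩
          rw [if_pos hcond, if_neg hvX, if_pos (Nat.pos_of_ne_zero hc),
            if_pos (Finset.mem_insert_self v X)]
          simp only [hblock.2 hb, if_true]
        · have h0 : s₃.reg 5 ≠ 0 := fun h => hb (hblock.1 h)
          rw [if_neg fun h : c ≠ 0 ∧ _ => hb h.2]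
          simp only [h0, if_false, mul_zero, add_zero]
    refine WP.store hZ (by decide) (by decide) fun _ => ?_
    rw [hval]
    refine ⟨by split_ifs <;> omega, fun i => ?_⟩
    simp only [Expr.eval, State.setArr_arr, if_true, h4, h8, Function.update_apply, Fin.val_inj]
    by_cases hi : i = v
    · rw [if_pos hi, hi]
    · rw [if_neg hi, hX i]
      have : i ∈ (if c ≠ 0 ∧ ∀ u ∈ X, ¬ G.Conflict v u then insert v X else X) ↔ i ∈ X := by
        split_ifs
        · simp [hi]
        · rfl
      simp only [this]

open Classical in
theorem wp_selectAll (hZ : 2 ≤ Z) (hn : n + 1 ≤ Z)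
    (h3 : ∀ i j : Fin n, s.arr 3 (i * n + j) = ind G.Conflict i j)
    (h8 : ∀ i : Fin n, s.arr 8 i = 0) {l : List (Fin n)} (hlen : l.length = n)
    (hl : Eliminated G w l s) : WP n Z selectAll s fun s' =>
      ∀ i : Fin n, s'.arr 8 i = if i ∈ select G.Conflict l (value G w) then 1 else 0 := by
  -- The recursion of `select` unwound from the end: `X m` is what it selects from position `m` on,
  -- with the values left after the first `m` reductions.
  let r : ℕ → Fin n → ℕ := fun m => (l.take m).foldl (reduce G.Conflict) (value G w)
  let X : ℕ → Finset (Fin n) := fun m => select G.Conflict (l.drop m) (r m)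
  have hX : ∀ (m : ℕ) (hm : m < l.length), X m =
      if r m l[m] ≠ 0 ∧ ∀ u ∈ X (m + 1), ¬ G.Conflict l[m] u then insert l[m] (X (m + 1))
      else X (m + 1) := by
    intro m hm
    have h1 : r (m + 1) = reduce G.Conflict (r m) l[m] := by
      simp only [r, List.take_add_one, List.getElem?_eq_getElem hm, Option.toList_some,
        List.foldl_append, List.foldl_cons, List.foldl_nil]
    simp only [X, h1]
    rw [List.drop_eq_getElem_cons hm, select]
    congr!
  refine (WP.loop hZ hn (by decide) (by decide)
    (fun t s' => ∀ i : Fin n, s'.arr 8 i = if i ∈ X (n - t) then 1 else 0) ?_ ?_).conseq ?_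
  · intro i
    simp [X, h8, ← hlen, select]
  · intro t ht s₁ f₁ _ h8₁ hI
    obtain ⟨m, hm⟩ : ∃ m, n - 1 - t = m := ⟨_, rfl⟩
    have hml : m < l.length := by omega
    rw [show n - t = m + 1 by omega] at hI
    rw [show n - (t + 1) = m by omega, hX m hml]
    refine wp_selectStep hZ hn ?_ hI h8₁ hm l[m] ?_ ?_
    · rw [f₁.arr 3 (by decide)]
      exact h3
    · rw [f₁.arr 5 (by decide), hl.order m hml]
    · rw [f₁.arr 7 (by decide), hl.reduction m hml]
  · intro s' _ _ h i
    simpa [X, r] using h i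

open Classical in
theorem wp_finish (hZ : 2 ≤ Z) (hn : n + 1 ≤ Z) {X : Finset (Fin n)}
    (hX : Independent G.Conflict X) (h8 : ∀ i : Fin n, s.arr 8 i = if i ∈ X then 1 else 0)
    (h9 : ∀ i : Fin n, s.arr 9 i = degree G i) : WP n Z finish s fun s' =>
      (∀ i : Fin n, s'.arr 0 i = if i ∈ X then 1 else 0) ∧ s'.reg 5 = ∑ v ∈ X, degree G v := by
  refine WP.seq ((WP.fillVec hZ hn (by decide) (by decide) (by decide)
    (fun i => if i ∈ X then 1 else 0) ?_).conseq fun s₁ f₁ _ h₁ => ?_)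
  · intro i s' hfr hok _ h1
    refine WP.assign hZ (by decide) (by decide) fun hok => ?_
    simp only [Expr.eval, h1, hfr.arr 8 (by decide), h8, State.setReg_reg, if_true, true_and,
      and_self]
    split_ifs <;> omega
  · have hsum : ∑ i, (if i ∈ X then 1 else 0) * degree G i = ∑ v ∈ X, degree G v := by
      simp [ite_mul, Finset.sum_ite_mem]
    refine (WP.sum hZ hn (by decide) (fun i => (if i ∈ X then 1 else 0) * degree G i) ?_ ?_).conseq
      fun s₂ f₂ _ h₂ => ⟨fun i => ?_, h₂.trans hsum⟩
    · rw [hsum]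
      have := sum_degree_le hX
      rw [Fintype.card_fin] at this
      omega
    · intro k s₂ _ harr _ h3
      simp only [Expr.eval, Op.eval, h3, harr, f₁.arr 8 (by decide), f₁.arr 9 (by decide), h8, h9]
    · rw [f₂.arr 0 (by decide), h₁ i]

open Classical in
theorem wp_algorithm (hZ : 2 ≤ Z) (hn : n + 1 ≤ Z) (hw : bigWeight w ≤ Z)
    (hnw : n * bigWeight w + 1 ≤ Z) (hC : IsChordal G) (hN : IsNetFree G) :
    WP n Z algorithm (input G w) fun s' => ∃ X : Finset (Fin n),
      (∀ i : Fin n, s'.arr 0 i = if i ∈ X then 1 else 0) ∧ s'.reg 5 = ∑ v ∈ X, degree G v ∧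
      IsWEDAnswer G w (if ∑ v ∈ X, degree G v = n then some X else none) := by
  refine WP.seq ((wp_setup hZ hn hw hnw).conseq fun s₁ f₁ _ h₁ => ?_)
  refine WP.seq ((wp_eliminate hZ hn hC hN h₁).conseq ?_)
  rintro s₂ f₂ - ⟨l, hlen, hl⟩
  refine WP.seq ((wp_selectAll hZ hn ?_ ?_ hlen hl).conseq fun s₃ f₃ _ h₃ => ?_)
  · rw [f₂.arr 3 (by decide)]
    exact h₁.conflict
  · rw [f₂.arr 8 (by decide)]
    exact h₁.chosen
  have hX : Independent G.Conflict (select G.Conflict l (value G w)) :=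
    independent_select (fun _ _ h => h.symm) _ _
  refine (wp_finish hZ hn hX h₃ ?_).conseq fun s₄ f₄ _ h₄ => ⟨_, h₄.1, h₄.2, ?_⟩
  · rw [f₃.arr 9 (by decide), f₂.arr 9 (by decide)]
    exact h₁.degree
  · have := isWEDAnswer_of_optimal hX (fun v hv => mem_select hv) fun hD I hI => by
      have helim := hl.elim hD
      refine sum_le_sum_select (fun u => ⟨u, Dom.refl u, Dom.refl u⟩) helim _ hI fun u _ => ?_
      -- An elimination order has no repetitions, so with `n` entries it contains every vertex.
      have huniv : l.toFinset = Finset.univ := by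
        refine Finset.eq_univ_of_card _ ?_
        rw [List.toFinset_card_of_nodup helim.nodup, hlen, Fintype.card_fin]
      exact List.mem_toFinset.1 (huniv ▸ Finset.mem_univ u)
    rwa [Fintype.card_fin] at this

theorem bigWeight_le (w : Fin n → ℕ∞) : bigWeight w ≤ 1 + n * (maxFiniteWeight w + 1) := by
  have h : ∀ i, weightCode (w i) ≤ maxFiniteWeight w + 1 := by
    intro i
    have h1 : (w i).toNat ≤ maxFiniteWeight w :=
      Finset.le_sup (f := fun i => (w i).toNat) (Finset.mem_univ i)
    by_cases h0 : weightCode (w i) = 0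
    · omega
    · rw [eq_weightCode h0, ENat.toNat_natCast] at h1
      omega
  have := Finset.sum_le_sum fun i (_ : i ∈ Finset.univ) => h i
  simp only [Finset.sum_const, Finset.card_univ, Fintype.card_fin, smul_eq_mul] at this
  simp only [bigWeight]
  omega

theorem solvableInTime : SolvableInTime (fun _ G => IsNetFree G ∧ IsChordal G)
    fun n => (algorithm.size + 4) * (n + 1) ^ 3 := by
  -- Stored values are at most `A ^ 4` and intermediate ones at most `(A ^ 4) ^ 5`, hence the
  -- exponent `20`. The last assignment stays outside the program logic because it overwrites the
  -- loop bound in register `0`.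
  refine ⟨.seq algorithm.compile (.assign 0 (.op .eq (.reg 5) (.reg 0))), 20, ?_⟩
  rintro n G w ⟨hN, hC⟩
  set A := n + maxFiniteWeight w + 2 with hA
  have hA2 : 2 ≤ A := by omega
  have hbw : bigWeight w ≤ A ^ 2 := by
    refine (bigWeight_le w).trans ?_
    rw [hA]
    nlinarith
  have hnA : n + 1 ≤ A := by omega
  have hnw : n * bigWeight w + 1 ≤ A ^ 4 := by
    have h1 := Nat.mul_le_mul (show n ≤ A by omega) hbw
    have h2 : 1 ≤ A ^ 3 := Nat.one_le_pow _ _ (by omega)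
    calc n * bigWeight w + 1 ≤ A * A ^ 2 + A ^ 3 := add_le_add h1 h2
      _ = 2 * A ^ 3 := by ring
      _ ≤ A * A ^ 3 := Nat.mul_le_mul_right _ hA2
      _ = A ^ 4 := by ring
  have hpow : ∀ k ≤ 4, A ^ k ≤ A ^ 4 := fun k hk => Nat.pow_le_pow_right (by omega) hk
  have hZ1 : A ≤ A ^ 4 := by simpa using hpow 1 (by decide)
  have hok : Ok n (A ^ 4) (input G w) := by
    refine ⟨by simp [input], fun x => ?_, fun a k => ?_⟩
    · simp only [input]
      split_ifs <;> omega
    · have hc : ∀ i, weightCode (w i) ≤ A ^ 4 := fun i =>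
        (weightCode_lt_bigWeight i).le.trans (hbw.trans (hpow 2 (by decide)))
      simp only [input]
      split_ifs <;> first | exact hc _ | omega
  obtain ⟨t, s, hrun, ht, -, hs, X, h0, h5, hans⟩ := wp_algorithm (hA2.trans hZ1)
    (hnA.trans hZ1) (hbw.trans (hpow 2 (by decide))) hnw hC hN hok
  rw [← pow_mul] at hrun
  have hfit := Expr.fits (k := 5) (hA2.trans hZ1) hs.bounded (.op .eq (.reg 5) (.reg 0)) (by decide)
  rw [← pow_mul] at hfit
  refine ⟨_, _, Run.seq hrun (Run.assign 0 _ s hfit), ?_, ?_⟩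
  · have h1 := ht.trans (algorithm.cost_le n)
    have h2 : algorithm.depth = 3 := by decide
    have h3 : 1 ≤ (n + 1) ^ 3 := Nat.one_le_pow _ _ (by omega)
    rw [h2] at h1
    simp only [Expr.cost]
    rw [add_mul]
    omega
  · have hreg : (s.setReg 0 (Expr.eval s (.op .eq (.reg 5) (.reg 0)))).reg 0 =
        if ∑ v ∈ X, degree G v = n then 1 else 0 := by
      simp [State.setReg_reg, Expr.eval, Op.eval, h5, hs.reg_zero]
    have hfilter : (Finset.univ.filter fun i : Fin n => s.arr 0 i ≠ 0) = X := by
      ext i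
      simp [h0 i]
    unfold output
    rw [hreg, State.setReg_arr, hfilter]
    by_cases h : ∑ v ∈ X, degree G v = n
    · simpa [h] using hans
    · simpa [h] using hans

end WED

/-- Weighted Efficient Domination is solvable in time `O(n³)` for net-free chordal graphs. -/
theorem corollary1 :
    ∃ T : ℕ → ℕ,
      (fun n : ℕ => (T n : ℝ)) =O[Filter.atTop] (fun n : ℕ => (n : ℝ) ^ 3) ∧
      WED.SolvableInTime (fun _ G => IsNetFree G ∧ IsChordal G) T := by
  refine ⟨_, ?_, WED.solvableInTime⟩
  generalize WED.algorithm.size + 4 = c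
  -- The factor `8` comes from `n + 1 ≤ 2 * n`, cubed.
  refine Asymptotics.IsBigO.of_bound (8 * c) ?_
  filter_upwards [Filter.eventually_ge_atTop 1] with n hn
  have h1 : (1 : ℝ) ≤ n := by exact_mod_cast hn
  have h2 : ((n : ℝ) + 1) ^ 3 ≤ (2 * n) ^ 3 := pow_le_pow_left₀ (by positivity) (by linarith) 3
  push_cast
  rw [Real.norm_of_nonneg (by positivity), Real.norm_of_nonneg (by positivity)]
  calc (c : ℝ) * (n + 1) ^ 3 ≤ c * (2 * n) ^ 3 := mul_le_mul_of_nonneg_left h2 (by positivity)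
    _ = 8 * c * n ^ 3 := by ring
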